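/- Let $X=(X_t)_{t\ge 0}$ be a real Lévy process with only positive jumps, i.e. $\mathbb{E}e^{i\xi X_t}=e^{-t\psi(\xi)}$ for $t\ge 0$, $\xi\in\mathbb{R}$, with $$\psi(\xi)=\sigma^2\xi^2-i\xi b-\int_{(0,\infty)}\bigl(e^{i\xi x}-1-i\xi x\mathbf{1}_{\{x<1\}}\bigr)\,\nu(dx),$$ where $\sigma\ge 0$, $b\in\mathbb{R}$ and $\nu$ is a measure on $(0,\infty)$ with $\int_{(0,\infty)}(1\wedge x^2)\,\nu(dx)<\infty$. Assume that $X$ is of unbounded variation. Let $\varphi$ be its Laplace exponent, $\mathbb{E}e^{-\lambda X_t}=e^{t\varphi(\lambda)}$ for $\lambda\ge 0$; $\varphi'(0)$ denotes $\varphi'(0^+)\in[-\infty,\infty)$, and $(\varphi')^{-1}$ denotes the inverse of the strictly increasing function $\varphi'$ on $(0,\infty)$. Suppose that for some $\alpha>0$, $c\in(0,1]$ and $x_0\ge 0$ $$\varphi''(\lambda x)\ge c\,\lambda^{\alpha-2}\varphi''(x)\qquad\text{for all }\lambda\ge 1,\ x>x_0 .$$ Then for every $t>0$ the law of $X_t$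 has a continuous density $p(t,\cdot)$. Moreover, for all $t>0$ and $x\in\mathbb{R}$ with $x<-t\varphi'(x_0)$ the number $w=(\varphi')^{-1}(-x/t)$ is well defined and satisfies $w>x_0$, and there are constants $M_0>0$ and $C\ge 1$ such that $$\frac{C^{-1}}{\sqrt{t\varphi''(w)}}\,e^{-t(w\varphi'(w)-\varphi(w))}\ \le\ p(t,x)\ \le\ \frac{C}{\sqrt{t\varphi''(w)}}\,e^{-t(w\varphi'(w)-\varphi(w))}$$ for all $t>0$ and $x\in\mathbb{R}$ such that $x<-t\varphi'(x_0)$ and $t w^2\varphi''(w)>M_0$. -/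

import Mathlib

open MeasureTheory ProbabilityTheory Filter Topology Set
open scoped NNReal ENNReal

namespace SpectrallyPositive

/-- `ω ↦ (X t ω)_{t ≥ 0}` is a real Lévy process under `P`: it starts at zero, has independent and
stationary increments, and almost surely its paths are right-continuous with left limits. -/
structure IsLevyProcess {Ω : Type*} [MeasurableSpace Ω] (P : Measure Ω) (X : ℝ≥0 → Ω → ℝ) :
    Prop where
  measurable : ∀ t, Measurable (X t)
  zero : ∀ᵐ ω ∂P, X 0 ω = 0
  indep : HasIndepIncrements X P
  stationary : ∀ s t : ℝ≥0, IdentDistrib (fun ω => X (s + t) ω - X s ω) (X t) P P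
  cadlag : ∀ᵐ ω ∂P, ∀ t : ℝ≥0,
    ContinuousWithinAt (fun s => X s ω) (Ici t) t ∧
      ∃ l : ℝ, Tendsto (fun s => X s ω) (𝓝[<] t) (𝓝 l)

/-- `ν` is a Lévy measure on `(0, ∞)`. -/
structure IsPositiveLevyMeasure (ν : Measure ℝ) : Prop where
  null_nonpos : ν (Iic 0) = 0
  lintegral_lt_top : ∫⁻ x, ENNReal.ofReal (min 1 (x ^ 2)) ∂ν < ∞

/-- The characteristic exponent
`ψ(ξ) = σ² ξ² - i ξ b - ∫ (e^{iξx} - 1 - i ξ x 1_{x < 1}) ν(dx)`. -/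
noncomputable def charExponent (σ b : ℝ) (ν : Measure ℝ) (ξ : ℝ) : ℂ :=
  (σ : ℂ) ^ 2 * (ξ : ℂ) ^ 2 - Complex.I * ξ * b -
    ∫ x : ℝ, (Complex.exp (Complex.I * ξ * x) - 1 -
      (Iio (1 : ℝ)).indicator (fun y : ℝ => Complex.I * ξ * y) x) ∂ν

/-- `X` is a spectrally positive Lévy process with Gaussian coefficient `σ`, drift `b` and Lévy
measure `ν`, which is carried by `(0, ∞)`: `E e^{iξ X_t} = e^{-t ψ(ξ)}`. -/
structure IsSpectrallyPositiveLevy {Ω : Type*} [MeasurableSpace Ω] (P : Measure Ω)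
    (X : ℝ≥0 → Ω → ℝ) (σ b : ℝ) (ν : Measure ℝ) : Prop where
  levy : IsLevyProcess P X
  sigma_nonneg : 0 ≤ σ
  levyMeasure : IsPositiveLevyMeasure ν
  charFun_eq : ∀ (t : ℝ≥0) (ξ : ℝ),
    charFun (P.map (X t)) ξ = Complex.exp (-((t : ℝ) : ℂ) * charExponent σ b ν ξ)

/-- The process is of unbounded variation: it is not the case that almost every path has bounded
variation on every compact time interval. -/
def IsOfUnboundedVariation {Ω : Type*} [MeasurableSpace Ω] (P : Measure Ω)
    (X : ℝ≥0 → Ω → ℝ) : Prop :=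
  ¬ ∀ᵐ ω ∂P, LocallyBoundedVariationOn (fun t => X t ω) univ

/-- The Laplace exponent `φ(l) = log E e^{-l X_1}` (used for `l ≥ 0`). -/
noncomputable def laplaceExponent {Ω : Type*} [MeasurableSpace Ω] (P : Measure Ω)
    (X : ℝ≥0 → Ω → ℝ) (l : ℝ) : ℝ :=
  Real.log (∫ ω, Real.exp (-l * X 1 ω) ∂P)

/-- The value `f'(a)`, read as the right limit `f'(a+)` in `[-∞, ∞]`. For the Laplace exponent and
`a > 0` it is the ordinary derivative, and for `a = 0` it is `-E X_1`, which may be `-∞`. -/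
noncomputable def rightDerivLimit (f : ℝ → ℝ) (a : ℝ) : EReal :=
  limUnder (𝓝[>] a) (fun w => ((deriv f w : ℝ) : EReal))

/-- The inverse function of `f'` on `(0, ∞)`. -/
noncomputable def derivInv (f : ℝ → ℝ) (y : ℝ) : ℝ :=
  Function.invFunOn (deriv f) (Ioi 0) y

/-- Weak lower scaling at infinity: `f(l x) ≥ c l^a f(x)` for all `l ≥ 1` and `x > x₁`. -/
def WLSC (f : ℝ → ℝ) (a c x₁ : ℝ) : Prop :=
  ∀ l : ℝ, 1 ≤ l → ∀ x : ℝ, x₁ < x → c * l ^ a * f x ≤ f (l * x)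

/-- `q` is a continuous probability density of the law `μ`. -/
structure IsContinuousDensity (μ : Measure ℝ) (q : ℝ → ℝ) : Prop where
  continuous : Continuous q
  nonneg : ∀ x, 0 ≤ q x
  eq_withDensity : μ = volume.withDensity (fun x => ENNReal.ofReal (q x))

end SpectrallyPositive

/-! The proof is a saddle-point argument. Tilt the law of `X t` by `e^{-wx}`, `w > x₀`. After
centring, the tilted law has characteristic function `e^{tΦ_w(ξ)}` with `Φ_w(ξ) = φ(w - iξ) - φ(w) +
iξφ'(w)` (`tiltedExponent`). Fourier inversion for the tilted law, multiplied by `e^{wx + tφ(w)}`,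
gives a continuous density, the same for every `w`. Choosing `φ'(w) = -x/t` removes the oscillating
factor and turns the prefactor into the exponential of the theorem. It remains to compare `∫
e^{tΦ_w}` with `(tφ''(w))^{-1/2}`.

In the variable `v = ξ√(tφ''(w))` the exponent is `-v²/2` up to an error of order `|v|³ /
√(tw²φ''(w))` (`norm_tiltedExponent_add_le`, `exists_le_mul_of_half`), which is small on compacts
once `tw²φ''(w)` is large. For the tails, `-Re Φ_w(ξ)` is at least `ξ²` times the Gaussian part plus
the second moment of the jumps below `1 / max(w, |ξ|)`. Lower scaling prevents `φ''` from being
carried by larger jumps (`exists_le_truncated_second_moment`), so this is comparable with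
`ξ²φ''(max(w, |ξ|))`; scaling once more gives an integrable majorant independent of `t` and `w`
(`exists_majorant`).

Two inputs are probabilistic. Only the characteristic function is given, so the Laplace transform on
the half-plane is obtained by approximating with compound Poisson and Gaussian convolutions
(`integral_exp_eq_of_charFun_eq`). Unbounded variation is a property of paths: if `φ' ≤ K`, then
`X_t + Kt` is nondecreasing (`not_isOfUnboundedVariation`). Hence `φ'` is unbounded above, `φ'' >
0`, and the saddle point exists (`derivInv_spec`). -/

namespace SpectrallyPositive

/-! ### The Lévy–Khintchine integrand on the closed right half-plane. -/

/-- The integrand of the Lévy–Khintchine formula at the complex frequency `z`. -/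
noncomputable def levyKernel (z : ℂ) (x : ℝ) : ℂ :=
  Complex.exp (-z * x) - 1 + (Iio (1 : ℝ)).indicator (fun y : ℝ => z * y) x

/-- The Laplace exponent extended to the right half-plane by the Lévy–Khintchine formula. -/
noncomputable def complexExponent (σ b : ℝ) (ν : Measure ℝ) (z : ℂ) : ℂ :=
  (σ : ℂ) ^ 2 * z ^ 2 - b * z + ∫ x : ℝ, levyKernel z x ∂ν

/-- The characteristic function is the Laplace transform on the imaginary axis, `z = -iξ`. -/
lemma neg_charExponent (σ b : ℝ) (ν : Measure ℝ) (ξ : ℝ) :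
    -charExponent σ b ν ξ = complexExponent σ b ν (-(ξ * Complex.I)) := by
  have h : ∀ x : ℝ, Complex.exp (Complex.I * ξ * x) - 1 -
      (Iio (1 : ℝ)).indicator (fun y : ℝ => Complex.I * ξ * y) x
        = levyKernel (-(ξ * Complex.I)) x := by
    intro x
    unfold levyKernel
    by_cases hx : x ∈ Iio (1 : ℝ)
    · simp only [indicator_of_mem hx]; ring_nf
    · simp only [indicator_of_notMem hx]; ring_nf
  unfold charExponent complexExponent
  simp_rw [h]
  linear_combination (σ : ℂ) ^ 2 * (ξ : ℂ) ^ 2 * (-1 : ℂ) * Complex.I_sq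

/-- Taylor's formula covers small `u`; for large `u` the condition on the real part keeps the
exponential bounded, so one quadratic bound holds globally. -/
lemma norm_exp_sub_one_sub_le {u : ℂ} (hu : u.re ≤ 0) : ‖Complex.exp u - 1 - u‖ ≤ 3 * ‖u‖ ^ 2 := by
  rcases le_total ‖u‖ 1 with h | h
  · exact (Complex.norm_exp_sub_one_sub_id_le h).trans (by nlinarith [sq_nonneg ‖u‖])
  · have h1 : ‖Complex.exp u‖ ≤ 1 := by
      rw [Complex.norm_exp]; exact Real.exp_le_one_iff.2 hu
    calc ‖Complex.exp u - 1 - u‖ ≤ ‖Complex.exp u‖ + ‖(1 : ℂ)‖ + ‖u‖ :=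
          (norm_sub_le _ _).trans (by gcongr; exact norm_sub_le _ _)
      _ ≤ 3 * ‖u‖ ^ 2 := by rw [norm_one]; nlinarith

lemma norm_exp_neg_mul_le_one {z : ℂ} (hz : 0 ≤ z.re) {x : ℝ} (hx : 0 ≤ x) :
    ‖Complex.exp (-z * x)‖ ≤ 1 := by
  rw [Complex.norm_exp]
  refine Real.exp_le_one_iff.2 ?_
  simp only [Complex.mul_re, Complex.neg_re, Complex.ofReal_re, Complex.ofReal_im, mul_zero,
    sub_zero]
  nlinarith [mul_nonneg hz hx]

lemma norm_levyKernel_le {z : ℂ} (hz : 0 ≤ z.re) {x : ℝ} (hx : 0 < x) :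
    ‖levyKernel z x‖ ≤ (2 + 3 * ‖z‖ ^ 2) * min 1 (x ^ 2) := by
  unfold levyKernel
  by_cases h1 : x ∈ Iio (1 : ℝ)
  · rw [indicator_of_mem h1]
    have h2 : min 1 (x ^ 2) = x ^ 2 := min_eq_right (by
      have : x < 1 := h1
      nlinarith)
    have h3 : (-z * (x : ℂ)).re ≤ 0 := by
      simp only [Complex.mul_re, Complex.neg_re, Complex.ofReal_re, Complex.ofReal_im, mul_zero,
        sub_zero]
      nlinarith [mul_nonneg hz hx.le]
    have h4 := norm_exp_sub_one_sub_le h3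
    have h5 : ‖-z * (x : ℂ)‖ ^ 2 = ‖z‖ ^ 2 * x ^ 2 := by
      rw [norm_mul, norm_neg, Complex.norm_real, mul_pow, Real.norm_eq_abs, sq_abs]
    rw [h2]
    calc _ = ‖Complex.exp (-z * x) - 1 - -z * x‖ := by congr 1; ring
      _ ≤ 3 * (‖z‖ ^ 2 * x ^ 2) := by rw [← h5]; exact h4
      _ ≤ _ := by nlinarith [sq_nonneg x]
  · rw [indicator_of_notMem h1, add_zero]
    have h2 : min 1 (x ^ 2) = 1 := min_eq_left (by
      have : 1 ≤ x := not_lt.1 h1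
      nlinarith)
    rw [h2, mul_one]
    calc _ ≤ ‖Complex.exp (-z * x)‖ + ‖(1 : ℂ)‖ := norm_sub_le _ _
      _ ≤ 1 + 1 := by rw [norm_one]; gcongr; exact norm_exp_neg_mul_le_one hz hx.le
      _ ≤ _ := by nlinarith [sq_nonneg ‖z‖]

@[fun_prop]
lemma measurable_levyKernel (z : ℂ) : Measurable (levyKernel z) := by
  unfold levyKernel
  refine Measurable.add (by fun_prop) (Measurable.indicator (by fun_prop) measurableSet_Iio)

namespace IsPositiveLevyMeasure
variable {ν : Measure ℝ} (hν : IsPositiveLevyMeasure ν)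
include hν

lemma ae_pos : ∀ᵐ x ∂ν, 0 < x := by
  rw [ae_iff]
  simpa [Iic] using hν.null_nonpos

lemma integrable_min : Integrable (fun x : ℝ => min 1 (x ^ 2)) ν := by
  refine ⟨by fun_prop, ?_⟩
  rw [hasFiniteIntegral_iff_ofReal (ae_of_all _ fun x => le_min zero_le_one (sq_nonneg x))]
  exact hν.lintegral_lt_top

lemma integrable_levyKernel {z : ℂ} (hz : 0 ≤ z.re) : Integrable (levyKernel z) ν := by
  refine (hν.integrable_min.const_mul (2 + 3 * ‖z‖ ^ 2)).mono' (by fun_prop) ?_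
  filter_upwards [hν.ae_pos] with x hx using norm_levyKernel_le hz hx

lemma measure_Ioi_lt_top {ε : ℝ} (hε : 0 < ε) : ν (Ioi ε) < ∞ := by
  have h := hν.integrable_min.measure_ge_lt_top (ε := min 1 (ε ^ 2)) (by positivity)
  refine lt_of_le_of_lt (measure_mono fun x hx => ?_) h
  have : ε < x := hx
  exact min_le_min_left _ (pow_le_pow_left₀ hε.le this.le 2)

end IsPositiveLevyMeasure

/-! ### Laplace transforms of convolutions and of compound Poisson laws -/

lemma integrable_exp_conv {μ ρ : Measure ℝ} [SFinite μ] [SFinite ρ] {z : ℂ}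
    (hμ : Integrable (fun x : ℝ => Complex.exp (-z * x)) μ)
    (hρ : Integrable (fun x : ℝ => Complex.exp (-z * x)) ρ) :
    Integrable (fun x : ℝ => Complex.exp (-z * x)) (μ ∗ ρ) ∧
      ∫ x : ℝ, Complex.exp (-z * x) ∂(μ ∗ ρ) =
        (∫ x : ℝ, Complex.exp (-z * x) ∂μ) * ∫ x : ℝ, Complex.exp (-z * x) ∂ρ := by
  have h : ∀ x y : ℝ, Complex.exp (-z * ((x + y : ℝ) : ℂ)) =
      Complex.exp (-z * x) * Complex.exp (-z * y) := by
    intro x y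
    rw [← Complex.exp_add]; push_cast; ring_nf
  have hi : Integrable (fun x : ℝ => Complex.exp (-z * x)) (μ ∗ ρ) := by
    unfold Measure.conv
    rw [integrable_map_measure (by fun_prop) (by fun_prop)]
    simpa only [Function.comp_def, h] using hμ.mul_prod hρ
  refine ⟨hi, ?_⟩
  rw [integral_conv hi]
  simp_rw [h, integral_const_mul, integral_mul_const]

lemma integrable_exp_of_ae_nonneg {μ : Measure ℝ} [IsFiniteMeasure μ] (hμ : ∀ᵐ x ∂μ, 0 ≤ x)
    {z : ℂ} (hz : 0 ≤ z.re) : Integrable (fun x : ℝ => Complex.exp (-z * x)) μ := by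
  refine (integrable_const (1 : ℝ)).mono' (by fun_prop) ?_
  filter_upwards [hμ] with x hx using norm_exp_neg_mul_le_one hz hx

/-- Convolution powers of a measure. -/
noncomputable def convPow (ρ : Measure ℝ) : ℕ → Measure ℝ
  | 0 => Measure.dirac 0
  | k + 1 => convPow ρ k ∗ ρ

instance isFiniteMeasure_convPow (ρ : Measure ℝ) [IsFiniteMeasure ρ] (k : ℕ) :
    IsFiniteMeasure (convPow ρ k) := by
  induction k with
  | zero => unfold convPow; infer_instance
  | succ k ih => unfold convPow; infer_instance

lemma convPow_univ (ρ : Measure ℝ) [IsFiniteMeasure ρ] (k : ℕ) :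
    convPow ρ k univ = ρ univ ^ k := by
  induction k with
  | zero => simp [convPow]
  | succ k ih =>
    rw [convPow, Measure.conv, Measure.map_apply (by fun_prop) MeasurableSet.univ, preimage_univ,
      ← univ_prod_univ, Measure.prod_prod, ih, pow_succ]

lemma convPow_ae_nonneg {ρ : Measure ℝ} [IsFiniteMeasure ρ] (hρ : ∀ᵐ x ∂ρ, 0 ≤ x) (k : ℕ) :
    ∀ᵐ x ∂(convPow ρ k), 0 ≤ x := by
  induction k with
  | zero => simp [convPow, ae_dirac_eq]
  | succ k ih =>
    rw [convPow, Measure.conv, ae_map_iff (by fun_prop) measurableSet_Ici]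
    have h1 := Measure.quasiMeasurePreserving_fst (μ := convPow ρ k) (ν := ρ) |>.ae ih
    have h2 := Measure.quasiMeasurePreserving_snd (μ := convPow ρ k) (ν := ρ) |>.ae hρ
    filter_upwards [h1, h2] with p hp1 hp2 using add_nonneg hp1 hp2

lemma integral_exp_convPow {ρ : Measure ℝ} [IsFiniteMeasure ρ] (hρ : ∀ᵐ x ∂ρ, 0 ≤ x)
    {z : ℂ} (hz : 0 ≤ z.re) (k : ℕ) :
    ∫ x : ℝ, Complex.exp (-z * x) ∂(convPow ρ k) = (∫ x : ℝ, Complex.exp (-z * x) ∂ρ) ^ k := by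
  induction k with
  | zero => simp [convPow]
  | succ k ih =>
    rw [convPow, (integrable_exp_conv (integrable_exp_of_ae_nonneg (convPow_ae_nonneg hρ k) hz)
      (integrable_exp_of_ae_nonneg hρ hz)).2, ih, pow_succ]

/-- The compound Poisson law with jump measure `ρ`. -/
noncomputable def compoundPoisson (ρ : Measure ℝ) : Measure ℝ :=
  ENNReal.ofReal (Real.exp (-(ρ.real univ))) •
    Measure.sum fun k : ℕ => (k.factorial : ℝ≥0)⁻¹ • convPow ρ k

instance isProbabilityMeasure_compoundPoisson (ρ : Measure ℝ) [IsFiniteMeasure ρ] :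
    IsProbabilityMeasure (compoundPoisson ρ) := by
  constructor
  have h : ∀ k : ℕ, ((k.factorial : ℝ≥0)⁻¹ • convPow ρ k) univ =
      ENNReal.ofReal (ρ.real univ ^ k / k.factorial) := by
    intro k
    rw [Measure.smul_apply, convPow_univ, ← ENNReal.ofReal_toReal (measure_ne_top ρ univ),
      ← measureReal_def, ← ENNReal.ofReal_pow measureReal_nonneg, div_eq_inv_mul,
      ENNReal.ofReal_mul (by positivity), ENNReal.smul_def, smul_eq_mul]
    congr 1
    rw [ENNReal.coe_nnreal_eq]; simp
  rw [compoundPoisson, Measure.smul_apply, Measure.sum_apply _ MeasurableSet.univ]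
  simp_rw [h]
  have hs := NormedSpace.expSeries_div_hasSum_exp (ρ.real univ)
  rw [← ENNReal.ofReal_tsum_of_nonneg (fun k => by positivity) hs.summable, hs.tsum_eq,
    ← congrFun Real.exp_eq_exp_ℝ, smul_eq_mul, ← ENNReal.ofReal_mul (by positivity), ← Real.exp_add]
  simp

lemma compoundPoisson_ae_nonneg {ρ : Measure ℝ} [IsFiniteMeasure ρ] (hρ : ∀ᵐ x ∂ρ, 0 ≤ x) :
    ∀ᵐ x ∂(compoundPoisson ρ), 0 ≤ x := by
  refine Measure.ae_smul_measure ?_ _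
  rw [ae_iff, Measure.sum_apply_eq_zero]
  intro k
  exact ae_iff.1 (Measure.ae_smul_measure (convPow_ae_nonneg hρ k) _)

/-- The transform is multiplicative on convolution powers, so the Poisson mixture sums to the
exponential series. -/
lemma integral_exp_compoundPoisson {ρ : Measure ℝ} [IsFiniteMeasure ρ] (hρ : ∀ᵐ x ∂ρ, 0 ≤ x)
    {z : ℂ} (hz : 0 ≤ z.re) :
    ∫ x : ℝ, Complex.exp (-z * x) ∂(compoundPoisson ρ) =
      Complex.exp (∫ x : ℝ, (Complex.exp (-z * x) - 1) ∂ρ) := by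
  have h0 := integrable_exp_of_ae_nonneg (compoundPoisson_ae_nonneg hρ) hz
  have hi : Integrable (fun x : ℝ => Complex.exp (-z * x))
      (Measure.sum fun k : ℕ => (k.factorial : ℝ≥0)⁻¹ • convPow ρ k) := by
    rw [compoundPoisson] at h0
    exact (integrable_smul_measure (by simp [Real.exp_pos]) (by simp)).1 h0
  rw [compoundPoisson, integral_smul_measure, integral_sum_measure hi,
    integral_sub (integrable_exp_of_ae_nonneg hρ hz) (integrable_const _)]
  simp_rw [integral_smul_nnreal_measure, integral_exp_convPow hρ hz]
  have hs := NormedSpace.expSeries_div_hasSum_exp (∫ x : ℝ, Complex.exp (-z * x) ∂ρ)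
  have e : ∀ k : ℕ, ((k.factorial : ℝ≥0)⁻¹ • (∫ x : ℝ, Complex.exp (-z * x) ∂ρ) ^ k) =
      (∫ x : ℝ, Complex.exp (-z * x) ∂ρ) ^ k / (k.factorial : ℂ) := by
    intro k
    rw [NNReal.smul_def, Complex.real_smul, div_eq_inv_mul]
    simp
  simp_rw [e]
  rw [hs.tsum_eq, ← congrFun Complex.exp_eq_exp_ℂ, ENNReal.toReal_ofReal (by positivity),
    Complex.real_smul, Complex.ofReal_exp, ← Complex.exp_add, integral_const]
  congr 1
  simp
  ring

lemma integrable_exp_gaussianReal (m : ℝ) (v : ℝ≥0) (z : ℂ) :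
    Integrable (fun x : ℝ => Complex.exp (-z * x)) (gaussianReal m v) ∧
      ∫ x : ℝ, Complex.exp (-z * x) ∂(gaussianReal m v) = Complex.exp (-z * m + v * z ^ 2 / 2) := by
  constructor
  · rw [← integrable_norm_iff (by fun_prop)]
    have := integrable_exp_mul_gaussianReal (μ := m) (v := v) (-z.re)
    refine this.congr (ae_of_all _ fun x => ?_)
    simp [Complex.norm_exp]
  · have := complexMGF_id_gaussianReal (μ := m) (v := v) (-z)
    simpa [complexMGF] using this

/-! ### From the characteristic function to the Laplace transform on the half-plane. -/

lemma charFun_eq_integral_exp_neg (μ : Measure ℝ) (ξ : ℝ) :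
    charFun μ ξ = ∫ x : ℝ, Complex.exp (-(-(ξ * Complex.I)) * x) ∂μ := by
  rw [charFun_apply_real]
  congr 1; ext x; ring_nf

/-- Along a weakly convergent sequence of laws on `ℝ` whose Laplace transforms converge at every
point of the right half-plane, the limit law has the limiting Laplace transform. -/
lemma integral_exp_of_tendsto {μs : ℕ → ProbabilityMeasure ℝ} {μ : ProbabilityMeasure ℝ}
    (hμ : Tendsto μs atTop (𝓝 μ)) {L : ℂ → ℂ}
    (hi : ∀ n, ∀ z : ℂ, 0 ≤ z.re → Integrable (fun x : ℝ => Complex.exp (-z * x)) (μs n : Measure ℝ))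
    (hL : ∀ z : ℂ, 0 ≤ z.re →
      Tendsto (fun n => ∫ x : ℝ, Complex.exp (-z * x) ∂(μs n : Measure ℝ)) atTop (𝓝 (L z)))
    {z : ℂ} (hz : 0 ≤ z.re) :
    Integrable (fun x : ℝ => Complex.exp (-z * x)) (μ : Measure ℝ) ∧
      ∫ x : ℝ, Complex.exp (-z * x) ∂(μ : Measure ℝ) = L z := by
  have key : ∀ l : ℝ, 0 ≤ l → Integrable (fun x : ℝ => Real.exp (-l * x)) (μ : Measure ℝ) ∧
      ∃ B : ℝ, 0 ≤ B ∧ ∫ x : ℝ, Real.exp (-l * x) ∂(μ : Measure ℝ) ≤ B ∧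
        ∀ n, Integrable (fun x : ℝ => Real.exp (-l * x)) (μs n : Measure ℝ) ∧
          ∫ x : ℝ, Real.exp (-l * x) ∂(μs n : Measure ℝ) ≤ B := by
    intro l hl
    have hir : ∀ n, Integrable (fun x : ℝ => Real.exp (-l * x)) (μs n : Measure ℝ) := by
      intro n
      have := (hi n (l : ℂ) (by simpa using hl)).norm
      refine this.congr (ae_of_all _ fun x => ?_)
      simp [Complex.norm_exp]
    have hb : Tendsto (fun n => ∫ x : ℝ, Real.exp (-l * x) ∂(μs n : Measure ℝ)) atTop
        (𝓝 (L l).re) := by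
      have h := (Complex.continuous_re.tendsto _).comp (hL (l : ℂ) (by simpa using hl))
      refine h.congr fun n => ?_
      simp only [Function.comp]
      rw [← Complex.ofReal_re (∫ x : ℝ, Real.exp (-l * x) ∂(μs n : Measure ℝ)),
        ← integral_complex_ofReal]
      simp
    obtain ⟨B, hB⟩ := hb.bddAbove_range
    have hBn : ∀ n, ∫ x : ℝ, Real.exp (-l * x) ∂(μs n : Measure ℝ) ≤ B := fun n => hB ⟨n, rfl⟩
    have hB0 : 0 ≤ B := (integral_nonneg fun x => (Real.exp_pos _).le).trans (hBn 0)
    -- Weak convergence only tests bounded functions, so the bound is first passed to the limit for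
    -- the exponential capped at `K`; monotone convergence then removes the cap.
    have htr : ∀ K : ℕ, ∫ x : ℝ, min (Real.exp (-l * x)) K ∂(μ : Measure ℝ) ≤ B := by
      intro K
      let f : BoundedContinuousFunction ℝ ℝ := BoundedContinuousFunction.ofNormedAddCommGroup
        (fun x : ℝ => min (Real.exp (-l * x)) K) (by fun_prop) K (fun x => by
          rw [Real.norm_of_nonneg (le_min (Real.exp_pos _).le (Nat.cast_nonneg K))]
          exact min_le_right _ _)
      have h := ProbabilityMeasure.tendsto_iff_forall_integral_tendsto.1 hμ f
      refine le_of_tendsto' h fun n => ?_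
      exact (integral_mono (f.integrable _) (hir n) fun x => min_le_left _ _).trans (hBn n)
    have hfin : ∫⁻ x : ℝ, ENNReal.ofReal (Real.exp (-l * x)) ∂(μ : Measure ℝ) ≤ ENNReal.ofReal B := by
      have hsup : ∀ x : ℝ, ENNReal.ofReal (Real.exp (-l * x)) =
          ⨆ K : ℕ, ENNReal.ofReal (min (Real.exp (-l * x)) K) := by
        intro x
        apply le_antisymm
        · obtain ⟨K, hK⟩ := exists_nat_ge (Real.exp (-l * x))
          refine le_iSup_of_le K ?_
          rw [min_eq_left hK]
        · exact iSup_le fun K => ENNReal.ofReal_le_ofReal (min_le_left _ _)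
      simp_rw [hsup]
      rw [lintegral_iSup (fun K => by fun_prop)]
      · refine iSup_le fun K => ?_
        rw [← ofReal_integral_eq_lintegral_ofReal]
        · exact ENNReal.ofReal_le_ofReal (htr K)
        · refine (integrable_const (K : ℝ)).mono' (by fun_prop) (ae_of_all _ fun x => ?_)
          rw [Real.norm_of_nonneg (le_min (Real.exp_pos _).le (Nat.cast_nonneg K))]
          exact min_le_right _ _
        · exact ae_of_all _ fun x => le_min (Real.exp_pos _).le (Nat.cast_nonneg K)
      · intro K K' h x
        refine ENNReal.ofReal_le_ofReal (min_le_min_left _ ?_)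
        exact_mod_cast h
    have hiμ : Integrable (fun x : ℝ => Real.exp (-l * x)) (μ : Measure ℝ) := by
      refine ⟨by fun_prop, ?_⟩
      rw [hasFiniteIntegral_iff_ofReal (ae_of_all _ fun x => (Real.exp_pos _).le)]
      exact hfin.trans_lt ENNReal.ofReal_lt_top
    refine ⟨hiμ, B, hB0, ?_, fun n => ⟨hir n, hBn n⟩⟩
    rw [integral_eq_lintegral_of_nonneg_ae (ae_of_all _ fun x => (Real.exp_pos _).le) (by fun_prop)]
    exact ENNReal.toReal_le_of_le_ofReal hB0 hfin
  have hnorm : ∀ x : ℝ, ‖Complex.exp (-z * x)‖ = Real.exp (-z.re * x) := by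
    intro x; simp [Complex.norm_exp]
  have hμz : Integrable (fun x : ℝ => Complex.exp (-z * x)) (μ : Measure ℝ) := by
    rw [← integrable_norm_iff (by fun_prop)]
    simpa only [hnorm] using (key z.re hz).1
  refine ⟨hμz, ?_⟩
  -- The transform at `2 Re z` bounds the second moment of `|e^{-zx}|` uniformly in `n`, which makes
  -- the truncation error `B / K` uniform.
  obtain ⟨hi2, B, hB0, hBμ, hBn⟩ := key (2 * z.re) (by linarith)
  -- truncation of the exponential at height `K`
  have hcut : ∀ (K : ℝ), 0 < K → ∀ x : ℝ,
      ‖Complex.exp (-z * x) - ((min 1 (K * Real.exp (z.re * x)) : ℝ) : ℂ) * Complex.exp (-z * x)‖ ≤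
        K⁻¹ * Real.exp (-(2 * z.re) * x) := by
    intro K hK x
    have e1 : Complex.exp (-z * x) - ((min 1 (K * Real.exp (z.re * x)) : ℝ) : ℂ) *
        Complex.exp (-z * x) =
        ((1 - min 1 (K * Real.exp (z.re * x)) : ℝ) : ℂ) * Complex.exp (-z * x) := by
      push_cast; ring
    rw [e1, norm_mul, hnorm, Complex.norm_real, Real.norm_of_nonneg (by simp)]
    have e2 : Real.exp (-(2 * z.re) * x) = Real.exp (-z.re * x) * Real.exp (-z.re * x) := by
      rw [← Real.exp_add]; ring_nf
    have e3 : Real.exp (z.re * x) * Real.exp (-z.re * x) = 1 := by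
      rw [← Real.exp_add]; simp
    rw [e2, ← mul_assoc]
    refine mul_le_mul_of_nonneg_right ?_ (Real.exp_pos _).le
    have h3 := Real.exp_pos (-z.re * x)
    rcases le_total 1 (K * Real.exp (z.re * x)) with h | h
    · rw [min_eq_left h, sub_self]; positivity
    · rw [min_eq_right h]
      have : 1 ≤ K⁻¹ * Real.exp (-z.re * x) := by
        rw [inv_mul_eq_div, le_div_iff₀ hK, one_mul]
        nlinarith
      have := mul_pos hK (Real.exp_pos (z.re * x))
      linarith
  have hcutint : ∀ (K : ℝ), 0 < K → Tendsto
      (fun n => ∫ x : ℝ, ((min 1 (K * Real.exp (z.re * x)) : ℝ) : ℂ) * Complex.exp (-z * x)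
        ∂(μs n : Measure ℝ)) atTop
      (𝓝 (∫ x : ℝ, ((min 1 (K * Real.exp (z.re * x)) : ℝ) : ℂ) * Complex.exp (-z * x)
        ∂(μ : Measure ℝ))) ∧ ∀ ρ : ProbabilityMeasure ℝ, Integrable (fun x : ℝ =>
          ((min 1 (K * Real.exp (z.re * x)) : ℝ) : ℂ) * Complex.exp (-z * x)) (ρ : Measure ℝ) := by
    intro K hK
    let f : BoundedContinuousFunction ℝ ℂ := BoundedContinuousFunction.ofNormedAddCommGroup
      (fun x : ℝ => ((min 1 (K * Real.exp (z.re * x)) : ℝ) : ℂ) * Complex.exp (-z * x))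
      (by fun_prop) K (fun x => by
        have h0 : 0 < K * Real.exp (z.re * x) := by positivity
        rw [norm_mul, hnorm, Complex.norm_real, Real.norm_of_nonneg (le_min zero_le_one h0.le)]
        calc _ ≤ K * Real.exp (z.re * x) * Real.exp (-z.re * x) := by
              gcongr; exact min_le_right _ _
          _ = K := by rw [mul_assoc, ← Real.exp_add]; simp)
    exact ⟨(ProbabilityMeasure.tendsto_iff_forall_integral_rclike_tendsto ℂ).1 hμ f,
      fun ρ => f.integrable _⟩
  have herr : ∀ (K : ℝ), 0 < K → ∀ ρ : ProbabilityMeasure ℝ,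
      Integrable (fun x : ℝ => Complex.exp (-z * x)) (ρ : Measure ℝ) →
      Integrable (fun x : ℝ => Real.exp (-(2 * z.re) * x)) (ρ : Measure ℝ) →
      ∫ x : ℝ, Real.exp (-(2 * z.re) * x) ∂(ρ : Measure ℝ) ≤ B →
      ‖∫ x : ℝ, Complex.exp (-z * x) ∂(ρ : Measure ℝ) -
        ∫ x : ℝ, ((min 1 (K * Real.exp (z.re * x)) : ℝ) : ℂ) * Complex.exp (-z * x)
          ∂(ρ : Measure ℝ)‖ ≤ K⁻¹ * B := by
    intro K hK ρ h1 h2 h3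
    rw [← integral_sub h1 ((hcutint K hK).2 ρ)]
    refine (norm_integral_le_of_norm_le (h2.const_mul K⁻¹) (ae_of_all _ (hcut K hK))).trans ?_
    rw [integral_const_mul]
    gcongr
  refine tendsto_nhds_unique ?_ (hL z hz)
  rw [Metric.tendsto_atTop]
  intro ε hε
  have hK : 0 < 4 * (B + 1) / ε := by positivity
  have hKB : (4 * (B + 1) / ε)⁻¹ * B ≤ ε / 4 := by
    rw [inv_div, div_mul_eq_mul_div, div_le_div_iff₀ (by positivity) (by positivity)]
    nlinarith
  obtain ⟨N, hN⟩ := Metric.tendsto_atTop.1 (hcutint _ hK).1 (ε / 4) (by positivity)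
  refine ⟨N, fun n hn => ?_⟩
  have a1 := hN n hn
  have a2 := (herr _ hK μ hμz hi2 hBμ).trans hKB
  have a3 := (herr _ hK (μs n) (hi n z hz) (hBn n).1 (hBn n).2).trans hKB
  rw [dist_eq_norm] at a1 ⊢
  set p := ∫ x : ℝ, Complex.exp (-z * x) ∂(μ : Measure ℝ)
  set q := ∫ x : ℝ, Complex.exp (-z * x) ∂(μs n : Measure ℝ)
  rw [norm_sub_rev] at a2
  calc _ ≤ _ := norm_sub_le_norm_sub_add_norm_sub _ _ _
    _ ≤ _ := add_le_add_left (norm_sub_le_norm_sub_add_norm_sub _ _ _) _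
    _ < ε := by linarith

lemma tendsto_setIntegral_Ioi_one_div {ν : Measure ℝ} (hν : IsPositiveLevyMeasure ν) {f : ℝ → ℂ}
    (hf : Integrable f ν) :
    Tendsto (fun n : ℕ => ∫ x in Ioi (1 / ((n : ℝ) + 1)), f x ∂ν) atTop (𝓝 (∫ x, f x ∂ν)) := by
  simp_rw [← integral_indicator measurableSet_Ioi]
  refine tendsto_integral_of_dominated_convergence (fun x => ‖f x‖)
    (fun n => hf.aestronglyMeasurable.indicator measurableSet_Ioi) hf.norm
    (fun n => ae_of_all _ fun x => norm_indicator_le_norm_self _ _) ?_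
  filter_upwards [hν.ae_pos] with x hx
  refine tendsto_const_nhds.congr' ?_
  filter_upwards [(tendsto_one_div_add_atTop_nhds_zero_nat (𝕜 := ℝ)).eventually_lt_const hx]
    with n hn
  rw [indicator_of_mem (mem_Ioi.2 hn)]

/-- The convolution of a compound Poisson law and a Gaussian law approximating the law with
Lévy triplet `(τσ², τb, τν)`: jumps of size at most `ε` are discarded. -/
noncomputable def truncatedLaw (σ b : ℝ) (ν : Measure ℝ) (τ : ℝ≥0) (ε : ℝ) : Measure ℝ :=
  compoundPoisson (τ • ν.restrict (Ioi ε)) ∗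
    gaussianReal (τ * (b - ∫ x in Ioi ε, (Iio (1 : ℝ)).indicator (fun y : ℝ => y) x ∂ν))
      (2 * (σ.toNNReal) ^ 2 * τ)

/-- Jumps above `ε` have finite total mass, so their compensator is an honest integral that can be
moved into the Gaussian mean. The variance is `2σ²τ` because the exponent contains `σ²z²` without
the factor `1/2`. -/
lemma integral_exp_truncatedLaw {σ : ℝ} (hσ : 0 ≤ σ) (b : ℝ) {ν : Measure ℝ}
    (hν : IsPositiveLevyMeasure ν) (τ : ℝ≥0) {ε : ℝ} (hε : 0 < ε) :
    IsProbabilityMeasure (truncatedLaw σ b ν τ ε) ∧ ∀ z : ℂ, 0 ≤ z.re →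
      Integrable (fun x : ℝ => Complex.exp (-z * x)) (truncatedLaw σ b ν τ ε) ∧
      ∫ x : ℝ, Complex.exp (-z * x) ∂(truncatedLaw σ b ν τ ε) =
        Complex.exp (τ * ((σ : ℂ) ^ 2 * z ^ 2 - b * z + ∫ x in Ioi ε, levyKernel z x ∂ν)) := by
  have : IsFiniteMeasure (ν.restrict (Ioi ε)) :=
    ⟨by rw [Measure.restrict_apply_univ]; exact hν.measure_Ioi_lt_top hε⟩
  have hae : ∀ᵐ x ∂(τ • ν.restrict (Ioi ε)), 0 ≤ x := by
    refine Measure.ae_smul_measure ?_ _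
    filter_upwards [ae_restrict_mem measurableSet_Ioi] with x hx using hε.le.trans (le_of_lt hx)
  constructor
  · unfold truncatedLaw; infer_instance
  intro z hz
  obtain ⟨hg1, hg2⟩ := integrable_exp_gaussianReal
    (τ * (b - ∫ x in Ioi ε, (Iio (1 : ℝ)).indicator (fun y : ℝ => y) x ∂ν))
      (2 * (σ.toNNReal) ^ 2 * τ) z
  obtain ⟨h1, h2⟩ := integrable_exp_conv
    (integrable_exp_of_ae_nonneg (compoundPoisson_ae_nonneg hae) hz) hg1
  refine ⟨h1, ?_⟩
  unfold truncatedLaw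
  rw [h2, hg2, integral_exp_compoundPoisson hae hz, ← Complex.exp_add, integral_smul_nnreal_measure]
  congr 1
  have hae' : ∀ᵐ x ∂(ν.restrict (Ioi ε)), 0 ≤ x := by
    filter_upwards [ae_restrict_mem measurableSet_Ioi] with x hx using hε.le.trans (le_of_lt hx)
  have hk : ∫ x in Ioi ε, levyKernel z x ∂ν = (∫ x in Ioi ε, (Complex.exp (-z * x) - 1) ∂ν) +
      z * ((∫ x in Ioi ε, (Iio (1 : ℝ)).indicator (fun y : ℝ => y) x ∂ν : ℝ) : ℂ) := by
    have hind : Integrable (fun x => (Iio (1 : ℝ)).indicator (fun y : ℝ => y) x)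
        (ν.restrict (Ioi ε)) := by
      refine (integrable_const (1 : ℝ)).mono'
        (measurable_id.indicator measurableSet_Iio).aestronglyMeasurable ?_
      filter_upwards [hae'] with x hx
      by_cases h : x ∈ Iio (1 : ℝ)
      · rw [indicator_of_mem h, Real.norm_of_nonneg hx]; exact le_of_lt h
      · rw [indicator_of_notMem h]; simp
    rw [← integral_complex_ofReal, ← integral_const_mul, ← integral_add]
    · congr 1; ext x
      unfold levyKernel
      by_cases h : x ∈ Iio (1 : ℝ)
      · simp [indicator_of_mem h]
      · simp [indicator_of_notMem h]
    · exact (integrable_exp_of_ae_nonneg hae' hz).sub (integrable_const _)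
    · exact hind.ofReal.const_mul _
  rw [hk, NNReal.smul_def, Complex.real_smul]
  have hs : ((σ.toNNReal : ℝ≥0) : ℝ) = σ := Real.coe_toNNReal σ hσ
  push_cast
  rw [hs]
  ring

/-- The Laplace transform of a spectrally positive infinitely divisible law is finite on the closed
right half-plane, where it is given by the Lévy–Khintchine formula. -/
theorem integral_exp_eq_of_charFun_eq {μ : Measure ℝ} [IsProbabilityMeasure μ] {σ : ℝ}
    (hσ : 0 ≤ σ) {b : ℝ} {ν : Measure ℝ} (hν : IsPositiveLevyMeasure ν) {τ : ℝ≥0}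
    (hμ : ∀ ξ : ℝ, charFun μ ξ = Complex.exp (-((τ : ℝ) : ℂ) * charExponent σ b ν ξ))
    {z : ℂ} (hz : 0 ≤ z.re) :
    Integrable (fun x : ℝ => Complex.exp (-z * x)) μ ∧
      ∫ x : ℝ, Complex.exp (-z * x) ∂μ = Complex.exp ((τ : ℝ) * complexExponent σ b ν z) := by
  have hpos : ∀ n : ℕ, 0 < 1 / ((n : ℝ) + 1) := fun n => Nat.one_div_pos_of_nat
  let μs : ℕ → ProbabilityMeasure ℝ := fun n =>
    ⟨truncatedLaw σ b ν τ (1 / ((n : ℝ) + 1)), (integral_exp_truncatedLaw hσ b hν τ (hpos n)).1⟩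
  have hL : ∀ z : ℂ, 0 ≤ z.re →
      Tendsto (fun n => ∫ x : ℝ, Complex.exp (-z * x) ∂(μs n : Measure ℝ)) atTop
        (𝓝 (Complex.exp ((τ : ℝ) * complexExponent σ b ν z))) := by
    intro z hz
    have h : ∀ n, ∫ x : ℝ, Complex.exp (-z * x) ∂(μs n : Measure ℝ) = _ :=
      fun n => ((integral_exp_truncatedLaw hσ b hν τ (hpos n)).2 z hz).2
    simp_rw [h]
    refine (Complex.continuous_exp.tendsto _).comp (Tendsto.const_mul _ ?_)
    exact Tendsto.const_add _ (tendsto_setIntegral_Ioi_one_div hν (hν.integrable_levyKernel hz))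
  have hw : Tendsto μs atTop (𝓝 (⟨μ, inferInstance⟩ : ProbabilityMeasure ℝ)) := by
    refine ProbabilityMeasure.tendsto_iff_tendsto_charFun.2 fun ξ => ?_
    simp only [ProbabilityMeasure.coe_mk]
    rw [hμ, neg_mul, ← mul_neg, neg_charExponent]
    simp_rw [charFun_eq_integral_exp_neg]
    exact hL _ (by simp)
  exact integral_exp_of_tendsto hw
    (fun n z hz => ((integral_exp_truncatedLaw hσ b hν τ (hpos n)).2 z hz).1) hL hz

/-! ### Fourier inversion for laws with integrable characteristic function. -/

open FourierTransform SchwartzMap in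
-- Two applications of the self-adjointness of the Fourier transform: write `h` as the transform of
-- `𝓕⁻ h`, move the transform onto `μ`, which produces `F`, and then move the inverse transform from
-- `h` to `F`.
lemma integral_schwartz_eq {μ : Measure ℝ} [IsProbabilityMeasure μ] {F : ℝ → ℂ}
    (hF : ∀ ξ, F ξ = charFun μ (-(2 * Real.pi) * ξ)) (hint : Integrable F) (h : 𝓢(ℝ, ℂ)) :
    ∫ x, h x ∂μ = ∫ x, 𝓕⁻ F x * h x := by
  have hF' : F = VectorFourier.fourierIntegral Real.fourierChar μ (innerₗ ℝ) (1 : ℝ → ℂ) := by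
    ext ξ
    rw [hF, charFun_eq_fourierIntegral']
    congr 1
    rw [smul_eq_mul]
    have := Real.pi_ne_zero
    field_simp
  have hg : (𝓕 (⇑(𝓕⁻ h : 𝓢(ℝ, ℂ))) : ℝ → ℂ) = h := by
    rw [← SchwartzMap.fourier_coe, FourierTransform.fourier_fourierInv_eq]
  have h1 := VectorFourier.integral_fourierIntegral_smul_eq_flip (e := Real.fourierChar)
    (μ := μ) (ν := volume) (L := innerₗ ℝ) (f := (1 : ℝ → ℂ)) (g := ⇑(𝓕⁻ h : 𝓢(ℝ, ℂ)))
    Real.continuous_fourierChar continuous_inner (integrable_const (1 : ℂ)) (𝓕⁻ h : 𝓢(ℝ, ℂ)).integrable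
  have h2 := VectorFourier.integral_fourierIntegral_smul_eq_flip (e := Real.fourierChar)
    (μ := volume) (ν := volume) (L := -innerₗ ℝ) (f := F) (g := ⇑h)
    Real.continuous_fourierChar (continuous_inner (𝕜 := ℝ) (E := ℝ)).neg
    hint h.integrable
  rw [← hF', flip_innerₗ] at h1
  have hflip : (-innerₗ ℝ).flip = -innerₗ ℝ := by
    ext; simp
  rw [hflip] at h2
  have e1 : VectorFourier.fourierIntegral Real.fourierChar volume (innerₗ ℝ) ⇑(𝓕⁻ h : 𝓢(ℝ, ℂ)) = h := hg
  have e2 : VectorFourier.fourierIntegral Real.fourierChar volume (-innerₗ ℝ) ⇑h = ⇑(𝓕⁻ h : 𝓢(ℝ, ℂ)) :=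
    (SchwartzMap.fourierInv_coe h).symm
  have e3 : VectorFourier.fourierIntegral Real.fourierChar volume (-innerₗ ℝ) F = 𝓕⁻ F := rfl
  rw [e1] at h1
  rw [e2, e3] at h2
  simp only [smul_eq_mul] at h1 h2
  rw [h2, h1]
  simp

/-- The Fourier inversion integral of the characteristic function of a law. -/
noncomputable def inversionDensity (μ : Measure ℝ) (x : ℝ) : ℝ :=
  (2 * Real.pi)⁻¹ * (∫ ξ : ℝ, Complex.exp (-(ξ * x * Complex.I)) * charFun μ ξ).re

open FourierTransform SchwartzMap in
/-- A law with integrable characteristic function has the continuous density given by the Fourier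
inversion formula. -/
theorem isContinuousDensity_inversionDensity {μ : Measure ℝ} [IsProbabilityMeasure μ]
    (hint : Integrable (charFun μ)) : IsContinuousDensity μ (inversionDensity μ) := by
  have hpi := Real.pi_pos
  have hpi' : -(2 * Real.pi) ≠ 0 := by linarith
  set F : ℝ → ℂ := fun ξ => charFun μ (-(2 * Real.pi) * ξ) with hFdef
  have hFint : Integrable F := hint.comp_mul_left' hpi'
  have hFcont : Continuous F := by
    have : Continuous (charFun μ) := by fun_prop
    exact this.comp (by fun_prop)
  have hQcont : Continuous (𝓕⁻ F) :=
    VectorFourier.fourierIntegral_continuous Real.continuous_fourierChar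
      (continuous_inner (𝕜 := ℝ) (E := ℝ)).neg hFint
  have hQ : ∀ x, 𝓕⁻ F x = ((2 * Real.pi)⁻¹ : ℝ) *
      ∫ ξ : ℝ, Complex.exp (-(ξ * x * Complex.I)) * charFun μ ξ := by
    intro x
    rw [Real.fourierInv_eq']
    have h := Measure.integral_comp_mul_left
      (fun ξ : ℝ => Complex.exp (-(ξ * x * Complex.I)) * charFun μ ξ) (-(2 * Real.pi))
    rw [abs_inv, abs_neg, abs_of_pos (by positivity), Complex.real_smul] at h
    rw [← h]
    congr 1; ext ξ
    simp only [smul_eq_mul, hFdef]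
    congr 2
    simp
    ring
  have hreal : ∀ x, 𝓕⁻ F x = (inversionDensity μ x : ℂ) := by
    intro x
    have hconj : (starRingEnd ℂ) (∫ ξ : ℝ, Complex.exp (-(ξ * x * Complex.I)) * charFun μ ξ) =
        ∫ ξ : ℝ, Complex.exp (-(ξ * x * Complex.I)) * charFun μ ξ := by
      rw [← integral_conj, ← integral_neg_eq_self]
      congr 1; ext ξ
      rw [map_mul, charFun_neg, Complex.conj_conj, ← Complex.exp_conj]
      congr 2
      simp
    rw [hQ, inversionDensity, Complex.ofReal_mul, Complex.conj_eq_iff_re.1 hconj]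
  have hqcont : Continuous (inversionDensity μ) := by
    have : inversionDensity μ = fun x => (𝓕⁻ F x).re := by
      ext x; rw [hreal, Complex.ofReal_re]
    rw [this]; exact Complex.continuous_re.comp hQcont
  have htest : ∀ (c : ℝ) (f : ContDiffBump c),
      ∫ x, f x ∂μ = ∫ x, inversionDensity μ x * f x := by
    intro c f
    have hcs : HasCompactSupport fun x => (f x : ℂ) := by
      exact f.hasCompactSupport.comp_left (g := fun y : ℝ => (y : ℂ)) rfl
    have hsm : ContDiff ℝ (⊤ : ℕ∞) fun x => (f x : ℂ) := Complex.ofRealCLM.contDiff.comp f.contDiff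
    have h := integral_schwartz_eq (μ := μ) (F := F) (fun ξ => rfl) hFint (hcs.toSchwartzMap hsm)
    have e : ∀ x, (hcs.toSchwartzMap hsm) x = (f x : ℂ) := fun x => rfl
    simp_rw [e, hreal, ← Complex.ofReal_mul] at h
    rw [integral_complex_ofReal, integral_complex_ofReal] at h
    exact_mod_cast h
  -- A negative value would persist on a ball, and a bump supported there would have a negative
  -- integral against `μ`.
  have hnn : ∀ x, 0 ≤ inversionDensity μ x := by
    intro x
    by_contra hx
    rw [not_le] at hx
    obtain ⟨r, hr, hball⟩ := Metric.eventually_nhds_iff_ball.1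
      (hqcont.continuousAt.eventually (eventually_lt_nhds hx))
    let f : ContDiffBump x := ⟨r / 2, r, by positivity, by linarith⟩
    have h0 : 0 ≤ ∫ x, f x ∂μ := integral_nonneg fun y => f.nonneg
    rw [htest] at h0
    have hcont : Continuous fun y => -(inversionDensity μ y * f y) :=
      (hqcont.mul f.continuous).neg
    have hpos := hcont.integral_pos_of_hasCompactSupport_nonneg_nonzero (μ := volume) (x := x)
      (f.hasCompactSupport.mul_left.neg) (fun y => by
        by_cases hy : y ∈ Metric.ball x r
        · have := hball y hy
          have := f.nonneg (x := y)
          simp only [Pi.zero_apply]; nlinarith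
        · have : f y = 0 := f.zero_of_le_dist (by simpa using hy)
          simp [this]) (by
        have : f x = 1 := f.one_of_mem_closedBall (by simp [f.rIn_pos.le])
        rw [this]; linarith)
    rw [integral_neg] at hpos
    linarith
  -- Bumps equal to `1` on balls of radius `n` are at most `1`, so the integrals over these balls
  -- are bounded by the total mass of `μ`.
  have hqint : Integrable (inversionDensity μ) := by
    refine (aecover_closedBall (μ := volume) (x := (0 : ℝ))
      tendsto_natCast_atTop_atTop).integrable_of_integral_bounded_of_nonneg_ae 1
      (fun n => hqcont.continuousOn.integrableOn_compact (isCompact_closedBall 0 _))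
      (ae_of_all _ hnn) (Eventually.of_forall fun n : ℕ => ?_)
    let f : ContDiffBump (0 : ℝ) := ⟨n + 1, n + 2, by positivity, by linarith⟩
    have hfi : Integrable (fun x => inversionDensity μ x * f x) :=
      (hqcont.mul f.continuous).integrable_of_hasCompactSupport f.hasCompactSupport.mul_left
    calc ∫ x in Metric.closedBall 0 (n : ℝ), inversionDensity μ x
        = ∫ x in Metric.closedBall 0 (n : ℝ), inversionDensity μ x * f x := by
          refine setIntegral_congr_fun Metric.isClosed_closedBall.measurableSet fun x hx => ?_
          have : f x = 1 := f.one_of_mem_closedBall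
            (Metric.closedBall_subset_closedBall (by simp [f]) hx)
          simp only [this, mul_one]
      _ ≤ ∫ x, inversionDensity μ x * f x :=
          setIntegral_le_integral hfi (ae_of_all _ fun x => mul_nonneg (hnn x) f.nonneg)
      _ = ∫ x, f x ∂μ := (htest 0 f).symm
      _ ≤ ∫ x, (1 : ℝ) ∂μ := integral_mono_of_nonneg (ae_of_all _ fun x => f.nonneg)
          (integrable_const _) (ae_of_all _ fun x => f.le_one)
      _ = 1 := by simp
  refine ⟨hqcont, hnn, ?_⟩
  have hfin : IsFiniteMeasure (volume.withDensity fun x => ENNReal.ofReal (inversionDensity μ x)) :=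
    isFiniteMeasure_withDensity_ofReal hqint.2
  refine Measure.ext_of_charFun (funext fun ξ => ?_)
  have hQint : Integrable (𝓕⁻ F) := by
    have : 𝓕⁻ F = fun x => (inversionDensity μ x : ℂ) := funext hreal
    rw [this]; exact hqint.ofReal
  have hFF : 𝓕 (𝓕⁻ F) = F := by
    refine hFcont.fourier_fourierInv_eq hFint ?_
    have := hQint.comp_neg
    refine this.congr (ae_of_all _ fun x => ?_)
    simp [Real.fourierInv_eq_fourier_neg]
  have h1 := congrFun hFF (-(2 * Real.pi)⁻¹ * ξ)
  have h2 : F (-(2 * Real.pi)⁻¹ * ξ) = charFun μ ξ := by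
    simp only [hFdef]
    congr 1
    field_simp
  rw [h2, Real.fourier_eq'] at h1
  rw [← h1, charFun_apply_real,
    integral_withDensity_eq_integral_toReal_smul (by fun_prop) (ae_of_all _ fun _ => by simp)]
  congr 1; ext x
  rw [ENNReal.toReal_ofReal (hnn x), hreal, Complex.real_smul, smul_eq_mul, mul_comm]
  congr 2
  simp
  field_simp

/-! ### The real Laplace exponent and its derivatives. -/

/-- The Lévy–Khintchine form of the Laplace exponent. -/
noncomputable def realExponent (σ b : ℝ) (ν : Measure ℝ) (l : ℝ) : ℝ :=
  σ ^ 2 * l ^ 2 - b * l +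
    ∫ x : ℝ, (Real.exp (-l * x) - 1 + l * (Iio (1 : ℝ)).indicator (fun y : ℝ => y) x) ∂ν

/-- The first derivative of the Laplace exponent. -/
noncomputable def realExponentDeriv (σ b : ℝ) (ν : Measure ℝ) (l : ℝ) : ℝ :=
  2 * σ ^ 2 * l - b +
    ∫ x : ℝ, ((Iio (1 : ℝ)).indicator (fun y : ℝ => y) x - x * Real.exp (-l * x)) ∂ν

/-- The second derivative of the Laplace exponent. -/
noncomputable def realExponentDeriv2 (σ : ℝ) (ν : Measure ℝ) (l : ℝ) : ℝ :=
  2 * σ ^ 2 + ∫ x : ℝ, x ^ 2 * Real.exp (-l * x) ∂ν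

lemma levyKernel_ofReal (l x : ℝ) : levyKernel l x =
    ((Real.exp (-l * x) - 1 + l * (Iio (1 : ℝ)).indicator (fun y : ℝ => y) x : ℝ) : ℂ) := by
  unfold levyKernel
  by_cases h : x ∈ Iio (1 : ℝ)
  · simp [indicator_of_mem h]
  · simp [indicator_of_notMem h]

lemma complexExponent_ofReal (σ b : ℝ) (ν : Measure ℝ) (l : ℝ) :
    complexExponent σ b ν l = (realExponent σ b ν l : ℂ) := by
  unfold complexExponent realExponent
  simp_rw [levyKernel_ofReal]
  rw [integral_complex_ofReal]
  push_cast
  ring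

lemma sq_mul_exp_neg_le {l x : ℝ} (hl : 0 < l) (hx : 0 < x) :
    x ^ 2 * Real.exp (-l * x) ≤ (1 + 2 / l ^ 2) * min 1 (x ^ 2) := by
  have h1 : Real.exp (-l * x) ≤ 1 := Real.exp_le_one_iff.2 (by nlinarith)
  have h2 : x ^ 2 * Real.exp (-l * x) ≤ 2 / l ^ 2 := by
    have h := Real.quadratic_le_exp_of_nonneg (mul_pos hl hx).le
    have h3 : Real.exp (-l * x) * Real.exp (l * x) = 1 := by rw [← Real.exp_add]; simp
    rw [le_div_iff₀ (by positivity)]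
    have h4 := Real.exp_pos (-l * x)
    have h5 : 0 < l * x := mul_pos hl hx
    nlinarith
  have h6 : 0 < 2 / l ^ 2 := by positivity
  rcases le_total 1 (x ^ 2) with h | h
  · rw [min_eq_left h]; linarith
  · rw [min_eq_right h]; nlinarith [sq_nonneg x, mul_nonneg h6.le (sq_nonneg x)]

lemma abs_indicator_sub_mul_exp_le {l x : ℝ} (hl : 0 < l) (hx : 0 < x) :
    |(Iio (1 : ℝ)).indicator (fun y : ℝ => y) x - x * Real.exp (-l * x)| ≤
      (l + (1 + 2 / l ^ 2)) * min 1 (x ^ 2) := by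
  have h0 := sq_mul_exp_neg_le hl hx
  have he := Real.exp_pos (-l * x)
  have hm : 0 ≤ min 1 (x ^ 2) := le_min zero_le_one (sq_nonneg x)
  by_cases h : x ∈ Iio (1 : ℝ)
  · have hx1 : x < 1 := h
    have h2 : min 1 (x ^ 2) = x ^ 2 := min_eq_right (by nlinarith)
    have h1 : Real.exp (-l * x) ≤ 1 := Real.exp_le_one_iff.2 (by nlinarith)
    have h3 := Real.add_one_le_exp (-l * x)
    have h6 : 0 < 2 / l ^ 2 := by positivity
    rw [indicator_of_mem h, abs_of_nonneg (by nlinarith), h2]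
    have : x * (1 - Real.exp (-l * x)) ≤ x * (l * x) :=
      mul_le_mul_of_nonneg_left (by linarith) hx.le
    nlinarith [mul_nonneg h6.le (sq_nonneg x), sq_nonneg x]
  · have hx1 : 1 ≤ x := not_lt.1 h
    rw [indicator_of_notMem h, zero_sub, abs_neg, abs_of_nonneg (by positivity)]
    have : x * Real.exp (-l * x) ≤ x ^ 2 * Real.exp (-l * x) :=
      mul_le_mul_of_nonneg_right (by nlinarith) he.le
    nlinarith [mul_nonneg hl.le hm]

lemma measurable_indicator_Iio : Measurable ((Iio (1 : ℝ)).indicator fun y : ℝ => y) :=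
  measurable_id.indicator measurableSet_Iio

section
variable {ν : Measure ℝ} (hν : IsPositiveLevyMeasure ν)
include hν

lemma IsPositiveLevyMeasure.integrable_sq_mul_exp {l : ℝ} (hl : 0 < l) :
    Integrable (fun x : ℝ => x ^ 2 * Real.exp (-l * x)) ν := by
  refine (hν.integrable_min.const_mul (1 + 2 / l ^ 2)).mono' (by fun_prop) ?_
  filter_upwards [hν.ae_pos] with x hx
  rw [Real.norm_of_nonneg (by positivity)]
  exact sq_mul_exp_neg_le hl hx

lemma IsPositiveLevyMeasure.integrable_indicator_sub_mul_exp {l : ℝ} (hl : 0 < l) :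
    Integrable (fun x : ℝ => (Iio (1 : ℝ)).indicator (fun y : ℝ => y) x - x * Real.exp (-l * x))
      ν := by
  refine (hν.integrable_min.const_mul (l + (1 + 2 / l ^ 2))).mono'
    (measurable_indicator_Iio.sub (by fun_prop)).aestronglyMeasurable ?_
  filter_upwards [hν.ae_pos] with x hx using abs_indicator_sub_mul_exp_le hl hx

lemma IsPositiveLevyMeasure.integrable_realKernel {l : ℝ} (hl : 0 ≤ l) :
    Integrable (fun x : ℝ =>
      Real.exp (-l * x) - 1 + l * (Iio (1 : ℝ)).indicator (fun y : ℝ => y) x) ν := by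
  have h : Integrable (fun x => levyKernel l x) ν :=
    hν.integrable_levyKernel (by simpa using hl)
  simp_rw [levyKernel_ofReal] at h
  exact h.re.congr (ae_of_all _ fun x => Complex.ofReal_re _)

lemma hasDerivAt_realExponent (σ b : ℝ) {l : ℝ} (hl : 0 < l) :
    HasDerivAt (realExponent σ b ν) (realExponentDeriv σ b ν l) l := by
  -- The bound of `abs_indicator_sub_mul_exp_le` degenerates at `0` and grows at infinity, so
  -- domination needs a neighbourhood bounded on both sides.
  have hmem : Ioo (l / 2) (2 * l) ∈ 𝓝 l := Ioo_mem_nhds (by linarith) (by linarith)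
  have h := (hasDerivAt_integral_of_dominated_loc_of_deriv_le (μ := ν)
    (F := fun l x => Real.exp (-l * x) - 1 + l * (Iio (1 : ℝ)).indicator (fun y : ℝ => y) x)
    (F' := fun l x => (Iio (1 : ℝ)).indicator (fun y : ℝ => y) x - x * Real.exp (-l * x))
    (bound := fun x => (2 * l + (1 + 2 / (l / 2) ^ 2)) * min 1 (x ^ 2)) hmem
    (Eventually.of_forall fun l => (Measurable.add (by fun_prop)
      (measurable_indicator_Iio.const_mul l)).aestronglyMeasurable)
    (hν.integrable_realKernel hl.le) (hν.integrable_indicator_sub_mul_exp hl).aestronglyMeasurable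
    ?_ (hν.integrable_min.const_mul _) ?_).2
  · have h2 : HasDerivAt (fun l : ℝ => σ ^ 2 * l ^ 2 - b * l) (2 * σ ^ 2 * l - b) l := by
      have := ((hasDerivAt_pow 2 l).const_mul (σ ^ 2)).sub ((hasDerivAt_id l).const_mul b)
      refine this.congr_deriv ?_
      simp; ring
    exact h2.add h
  · filter_upwards [hν.ae_pos] with x hx y hy
    refine (abs_indicator_sub_mul_exp_le ((half_pos hl).trans hy.1) hx).trans ?_
    refine mul_le_mul_of_nonneg_right ?_ (le_min zero_le_one (sq_nonneg x))
    have h1 := hy.1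
    have h2 := hy.2
    gcongr
  · refine ae_of_all _ fun x y _ => ?_
    have h1 : HasDerivAt (fun y : ℝ => Real.exp (-y * x)) (Real.exp (-y * x) * (-x)) y := by
      refine HasDerivAt.exp ?_
      simpa using (hasDerivAt_id y).neg.mul_const x
    refine ((h1.sub_const 1).add ((hasDerivAt_id y).mul_const _)).congr_deriv ?_
    simp; ring

lemma hasDerivAt_realExponentDeriv (σ b : ℝ) {l : ℝ} (hl : 0 < l) :
    HasDerivAt (realExponentDeriv σ b ν) (realExponentDeriv2 σ ν l) l := by
  have hmem : Ioo (l / 2) (2 * l) ∈ 𝓝 l := Ioo_mem_nhds (by linarith) (by linarith)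
  have h := (hasDerivAt_integral_of_dominated_loc_of_deriv_le (μ := ν)
    (F := fun l x => (Iio (1 : ℝ)).indicator (fun y : ℝ => y) x - x * Real.exp (-l * x))
    (F' := fun l x => x ^ 2 * Real.exp (-l * x))
    (bound := fun x => x ^ 2 * Real.exp (-(l / 2) * x)) hmem
    (Eventually.of_forall fun l => (measurable_indicator_Iio.sub
      (by fun_prop)).aestronglyMeasurable)
    (hν.integrable_indicator_sub_mul_exp hl) (hν.integrable_sq_mul_exp hl).aestronglyMeasurable
    ?_ (hν.integrable_sq_mul_exp (half_pos hl)) ?_).2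
  · have h2 : HasDerivAt (fun l : ℝ => 2 * σ ^ 2 * l - b) (2 * σ ^ 2) l := by
      simpa using ((hasDerivAt_id l).const_mul (2 * σ ^ 2)).sub_const b
    exact h2.add h
  · filter_upwards [hν.ae_pos] with x hx y hy
    rw [Real.norm_of_nonneg (by positivity)]
    have := hy.1
    gcongr
  · refine ae_of_all _ fun x y _ => ?_
    have h1 : HasDerivAt (fun y : ℝ => Real.exp (-y * x)) (Real.exp (-y * x) * (-x)) y := by
      refine HasDerivAt.exp ?_
      simpa using (hasDerivAt_id y).neg.mul_const x
    refine ((h1.const_mul x).const_sub _).congr_deriv ?_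
    ring

lemma realExponentDeriv2_antitoneOn (σ : ℝ) : AntitoneOn (realExponentDeriv2 σ ν) (Ioi 0) := by
  intro l hl m hm hlm
  refine add_le_add_right (integral_mono_ae (hν.integrable_sq_mul_exp hm)
    (hν.integrable_sq_mul_exp hl) ?_) _
  filter_upwards [hν.ae_pos] with x hx
  gcongr

omit hν in
lemma realExponentDeriv2_nonneg (σ l : ℝ) : 0 ≤ realExponentDeriv2 σ ν l :=
  add_nonneg (by positivity) (integral_nonneg fun x => by positivity)

/-- The second derivative vanishes either nowhere or identically. -/
lemma realExponentDeriv2_eq_zero (σ : ℝ) {l : ℝ} (hl : 0 < l)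
    (h : realExponentDeriv2 σ ν l = 0) (m : ℝ) : realExponentDeriv2 σ ν m = 0 := by
  have h1 : 0 ≤ ∫ x : ℝ, x ^ 2 * Real.exp (-l * x) ∂ν := integral_nonneg fun x => by positivity
  unfold realExponentDeriv2 at h ⊢
  have h2 : ∫ x : ℝ, x ^ 2 * Real.exp (-l * x) ∂ν = 0 := by nlinarith [sq_nonneg σ]
  have h3 : 2 * σ ^ 2 = 0 := by linarith
  rw [integral_eq_zero_iff_of_nonneg (fun x => by positivity) (hν.integrable_sq_mul_exp hl)] at h2
  rw [h3, zero_add]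
  refine integral_eq_zero_of_ae ?_
  filter_upwards [h2, hν.ae_pos] with x hx hx0
  exact absurd hx (by simp only [Pi.zero_apply]; positivity)

end

/-! ### Unbounded variation forces the derivative of the exponent to be unbounded above. -/

/-- Markov's inequality: mass on `Y ≤ -δ` would make the moments grow at least like `e^{nδ}`. Rates
start at `1` because the application controls the exponent only on `[1, ∞)`. -/
lemma ae_nonneg_of_integral_exp_le {Ω : Type*} [MeasurableSpace Ω] {P : Measure Ω}
    [IsFiniteMeasure P] {Y : Ω → ℝ} {C : ℝ}
    (hi : ∀ n : ℕ, Integrable (fun ω => Real.exp (-((n : ℝ) + 1) * Y ω)) P)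
    (hC : ∀ n : ℕ, ∫ ω, Real.exp (-((n : ℝ) + 1) * Y ω) ∂P ≤ C) : ∀ᵐ ω ∂P, 0 ≤ Y ω := by
  have key : ∀ δ : ℝ, 0 < δ → P.real {ω | Y ω ≤ -δ} = 0 := by
    intro δ hδ
    have h1 : ∀ n : ℕ, P.real {ω | Y ω ≤ -δ} ≤ C * Real.exp (-(n * δ)) := by
      intro n
      have h := mul_meas_ge_le_integral_of_nonneg (ae_of_all P fun ω => (Real.exp_pos _).le) (hi n)
        (Real.exp (n * δ))
      have hsub : P.real {ω | Y ω ≤ -δ} ≤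
          P.real {ω | Real.exp (n * δ) ≤ Real.exp (-((n : ℝ) + 1) * Y ω)} := by
        refine measureReal_mono fun ω hω => Real.exp_le_exp.2 ?_
        have hω' : Y ω ≤ -δ := hω
        have hn : (0 : ℝ) ≤ n := Nat.cast_nonneg n
        nlinarith
      rw [Real.exp_neg, ← div_eq_mul_inv, le_div_iff₀ (Real.exp_pos _)]
      nlinarith [hC n, Real.exp_pos (n * δ)]
    have h2 : Tendsto (fun n : ℕ => C * Real.exp (-(n * δ))) atTop (𝓝 (C * 0)) := by
      refine Tendsto.const_mul C (Real.tendsto_exp_neg_atTop_nhds_zero.comp ?_)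
      exact tendsto_natCast_atTop_atTop.atTop_mul_const hδ
    rw [mul_zero] at h2
    exact le_antisymm (ge_of_tendsto' h2 h1) measureReal_nonneg
  have h3 : ∀ᵐ ω ∂P, ∀ n : ℕ, -(1 / ((n : ℝ) + 1)) < Y ω := by
    rw [ae_all_iff]
    intro n
    have := key _ (Nat.one_div_pos_of_nat (α := ℝ) (n := n))
    rw [measureReal_eq_zero_iff] at this
    rw [ae_iff]
    simpa using this
  filter_upwards [h3] with ω hω
  have h4 := (tendsto_one_div_add_atTop_nhds_zero_nat (𝕜 := ℝ)).neg
  rw [neg_zero] at h4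
  exact le_of_tendsto' h4 fun n => (hω n).le

/-- A right-continuous function that is monotone on a dense countable set is monotone. -/
lemma monotone_of_dense {f : ℝ≥0 → ℝ} {S : Set ℝ≥0} (hS : Dense S)
    (hf : ∀ t, ContinuousWithinAt f (Ici t) t) (hm : ∀ s ∈ S, ∀ t ∈ S, s ≤ t → f s ≤ f t) :
    Monotone f := by
  have approx : ∀ (t u : ℝ≥0), t < u → ∀ p : ℝ → Prop, (∀ᶠ y in 𝓝 (f t), p y) →
      ∃ q ∈ S, t < q ∧ q < u ∧ p (f q) := by
    intro t u htu p hp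
    have h1 : ∀ᶠ q in 𝓝[>] t, p (f q) :=
      ((hf t).mono Ioi_subset_Ici_self).eventually hp
    rw [eventually_nhdsWithin_iff] at h1
    obtain ⟨v, hv, hvI⟩ := exists_Ico_subset_of_mem_nhds h1 ⟨u, htu⟩
    obtain ⟨q, hqS, hq⟩ := hS.exists_between (lt_min hv htu)
    exact ⟨q, hqS, hq.1, hq.2.trans_le (min_le_right _ _),
      hvI ⟨hq.1.le, hq.2.trans_le (min_le_left _ _)⟩ hq.1⟩
  intro s t hst
  rcases hst.eq_or_lt with rfl | hst
  · exact le_rfl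
  by_contra hlt
  rw [not_le] at hlt
  obtain ⟨m, hm1, hm2⟩ := exists_between hlt
  obtain ⟨q, hqS, -, hqt, hq⟩ := approx s t hst (fun y => m < y) (eventually_gt_nhds hm2)
  obtain ⟨r, hrS, htr, -, hr⟩ := approx t (t + 1) (by simp) (fun y => y < m)
    (eventually_lt_nhds hm1)
  have := hm q hqS r hrS (hqt.trans htr).le
  linarith

/-- A function whose increments are dominated by those of a monotone function is locally of bounded
variation. -/
lemma locallyBoundedVariationOn_of_abs_sub_le {f g : ℝ≥0 → ℝ} (hg : Monotone g)
    (h : ∀ s t, s ≤ t → |f t - f s| ≤ g t - g s) : LocallyBoundedVariationOn f univ := by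
  intro a b ha hb
  have hgv := (hg.monotoneOn univ).locallyBoundedVariationOn a b ha hb
  refine ne_top_of_le_ne_top hgv (iSup_mono fun p => Finset.sum_le_sum fun i _ => ?_)
  have hp : (p.2.1 : ℕ → ℝ≥0) i ≤ (p.2.1 : ℕ → ℝ≥0) (i + 1) := p.2.2.1 (Nat.le_succ i)
  rw [edist_dist, edist_dist, Real.dist_eq, Real.dist_eq]
  exact ENNReal.ofReal_le_ofReal ((h _ _ hp).trans (le_abs_self _))

namespace IsSpectrallyPositiveLevy

variable {Ω : Type*} [MeasurableSpace Ω] {P : Measure Ω} [IsProbabilityMeasure P]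
  {X : ℝ≥0 → Ω → ℝ} {σ b : ℝ} {ν : Measure ℝ} (hX : IsSpectrallyPositiveLevy P X σ b ν)
include hX

lemma isProbabilityMeasure_map (t : ℝ≥0) : IsProbabilityMeasure (P.map (X t)) :=
  Measure.isProbabilityMeasure_map (hX.levy.measurable t).aemeasurable

lemma integral_cexp (t : ℝ≥0) {z : ℂ} (hz : 0 ≤ z.re) :
    Integrable (fun x : ℝ => Complex.exp (-z * x)) (P.map (X t)) ∧
      ∫ x : ℝ, Complex.exp (-z * x) ∂(P.map (X t)) =
        Complex.exp ((t : ℝ) * complexExponent σ b ν z) :=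
  have := hX.isProbabilityMeasure_map t
  integral_exp_eq_of_charFun_eq hX.sigma_nonneg hX.levyMeasure (hX.charFun_eq t) hz

lemma integral_rexp_map (t : ℝ≥0) {l : ℝ} (hl : 0 ≤ l) :
    Integrable (fun x : ℝ => Real.exp (-l * x)) (P.map (X t)) ∧
      ∫ x : ℝ, Real.exp (-l * x) ∂(P.map (X t)) = Real.exp (t * realExponent σ b ν l) := by
  obtain ⟨h1, h2⟩ := hX.integral_cexp t (z := (l : ℂ)) (by simpa using hl)
  have e : ∀ x : ℝ, Complex.exp (-(l : ℂ) * x) = (Real.exp (-l * x) : ℂ) := by intro x; simp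
  simp_rw [e] at h1 h2
  refine ⟨h1.re.congr (ae_of_all _ fun x => Complex.ofReal_re _), ?_⟩
  rw [integral_complex_ofReal, complexExponent_ofReal] at h2
  exact_mod_cast h2

lemma integral_rexp (t : ℝ≥0) {l : ℝ} (hl : 0 ≤ l) :
    Integrable (fun ω => Real.exp (-l * X t ω)) P ∧
      ∫ ω, Real.exp (-l * X t ω) ∂P = Real.exp (t * realExponent σ b ν l) := by
  obtain ⟨h1, h2⟩ := hX.integral_rexp_map t hl
  have hm := (hX.levy.measurable t).aemeasurable (μ := P)
  rw [integrable_map_measure (by fun_prop) hm] at h1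
  rw [integral_map hm (by fun_prop)] at h2
  exact ⟨h1, h2⟩

lemma laplaceExponent_eq {l : ℝ} (hl : 0 ≤ l) : laplaceExponent P X l = realExponent σ b ν l := by
  rw [laplaceExponent, (hX.integral_rexp 1 hl).2]
  simp

lemma deriv_laplaceExponent {l : ℝ} (hl : 0 < l) :
    deriv (laplaceExponent P X) l = realExponentDeriv σ b ν l := by
  rw [← (hasDerivAt_realExponent hX.levyMeasure σ b hl).deriv]
  refine EventuallyEq.deriv_eq ?_
  filter_upwards [lt_mem_nhds hl] with y hy using hX.laplaceExponent_eq (le_of_lt hy)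

lemma deriv_deriv_laplaceExponent {l : ℝ} (hl : 0 < l) :
    deriv (deriv (laplaceExponent P X)) l = realExponentDeriv2 σ ν l := by
  rw [← (hasDerivAt_realExponentDeriv hX.levyMeasure σ b hl).deriv]
  refine EventuallyEq.deriv_eq ?_
  filter_upwards [lt_mem_nhds hl] with y hy using hX.deriv_laplaceExponent hy

/-- If the derivative of the Laplace exponent is bounded above, then the process is the sum of a
linear drift and a nondecreasing process, so it is of bounded variation. -/
lemma not_isOfUnboundedVariation {K : ℝ} (hK : ∀ l : ℝ, 0 < l → realExponentDeriv σ b ν l ≤ K) :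
    ¬ IsOfUnboundedVariation P X := by
  rw [IsOfUnboundedVariation, not_not]
  have hgrow : ∀ l : ℝ, 1 ≤ l → realExponent σ b ν l ≤ realExponent σ b ν 1 + K * (l - 1) := by
    intro l hl
    have hd : ∀ x : ℝ, 1 ≤ x → HasDerivAt (realExponent σ b ν) (realExponentDeriv σ b ν x) x :=
      fun x hx => hasDerivAt_realExponent hX.levyMeasure σ b (by linarith)
    have := (convex_Ici (1 : ℝ)).image_sub_le_mul_sub_of_deriv_le (f := realExponent σ b ν) (C := K)
      (fun x hx => (hd x hx).continuousAt.continuousWithinAt)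
      (fun x hx => (hd x (interior_subset hx)).differentiableAt.differentiableWithinAt)
      (fun x hx => by
        have h1 : 1 ≤ x := interior_subset hx
        rw [(hd x h1).deriv]; exact hK x (by linarith)) 1 (by simp) l hl hl
    linarith
  have hpos : ∀ t : ℝ≥0, ∀ᵐ ω ∂P, 0 ≤ X t ω + K * t := by
    intro t
    have e : ∀ (n : ℕ) (ω : Ω), Real.exp (-((n : ℝ) + 1) * (X t ω + K * t)) =
        Real.exp (-((n : ℝ) + 1) * X t ω) * Real.exp (-((n : ℝ) + 1) * (K * t)) := by
      intro n ω; rw [← Real.exp_add]; ring_nf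
    have hn : ∀ n : ℕ, (0 : ℝ) ≤ (n : ℝ) + 1 := fun n => by positivity
    -- The moment at rate `l = n + 1` is `exp(t(φ(l) - Kl))`, and `hgrow` says that `φ(l) - Kl` is
    -- at most its value at `l = 1`.
    refine ae_nonneg_of_integral_exp_le (C := Real.exp (t * (realExponent σ b ν 1 - K)))
      (fun n => ?_) (fun n => ?_)
    · simp_rw [e]
      exact (hX.integral_rexp t (hn n)).1.mul_const _
    · simp_rw [e]
      rw [integral_mul_const, (hX.integral_rexp t (hn n)).2, ← Real.exp_add]
      refine Real.exp_le_exp.2 ?_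
      have h1 := hgrow ((n : ℝ) + 1) (by simp)
      have h2 := mul_le_mul_of_nonneg_left h1 t.coe_nonneg
      linarith
  have hincr : ∀ s t : ℝ≥0, ∀ᵐ ω ∂P, X s ω + K * s ≤ X (s + t) ω + K * (s + t) := by
    intro s t
    have h := (hX.levy.stationary s t).symm.ae_mem_snd (t := {x : ℝ | 0 ≤ x + K * t})
      (measurableSet_le measurable_const (by fun_prop)) (hpos t)
    filter_upwards [h] with ω hω
    have : 0 ≤ X (s + t) ω - X s ω + K * t := hω
    linarith
  obtain ⟨S, hSc, hSd⟩ := TopologicalSpace.exists_countable_dense ℝ≥0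
  have hall : ∀ᵐ ω ∂P, ∀ s ∈ S, ∀ t ∈ S, s ≤ t → X s ω + K * s ≤ X t ω + K * t := by
    rw [ae_ball_iff hSc]
    intro s _
    rw [ae_ball_iff hSc]
    intro t _
    by_cases hst : s ≤ t
    · filter_upwards [hincr s (t - s)] with ω hω _
      rw [add_tsub_cancel_of_le hst, NNReal.coe_sub hst] at hω
      linarith
    · exact ae_of_all _ fun ω h => absurd h hst
  filter_upwards [hall, hX.levy.cadlag] with ω hω hc
  have hmono : Monotone fun t : ℝ≥0 => X t ω + K * t := by
    refine monotone_of_dense hSd (fun t => (hc t).1.add ?_) hω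
    exact Continuous.continuousWithinAt (by fun_prop)
  have habs : Monotone fun t : ℝ≥0 => |K| * (t : ℝ) := fun s t hst =>
    mul_le_mul_of_nonneg_left (by exact_mod_cast hst) (abs_nonneg K)
  have hdrift : ∀ s t : ℝ≥0, s ≤ t → |K * (t : ℝ) - K * s| ≤ |K| * t - |K| * s := by
    intro s t hst
    have : (s : ℝ) ≤ t := by exact_mod_cast hst
    rw [← mul_sub, abs_mul, abs_of_nonneg (sub_nonneg.2 this), mul_sub]
  -- The path is a monotone function minus the drift `Kt`; the term `|K|t` dominates the drift
  -- whatever the sign of `K`.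
  refine locallyBoundedVariationOn_of_abs_sub_le (hmono.add habs) fun s t hst => ?_
  have h1 := hmono hst
  have h2 := abs_le.1 (hdrift s t hst)
  simp only at h1
  rw [abs_le]
  constructor <;> linarith [h2.1, h2.2]

end IsSpectrallyPositiveLevy

/-! ### The tilted exponent: decay of its real part and its quadratic approximation. -/

/-- The exponent of the exponentially tilted and centred law: the analytic continuation of
`φ(w - iξ) - φ(w) + iξ φ'(w)`. -/
noncomputable def tiltedExponent (σ : ℝ) (ν : Measure ℝ) (w ξ : ℝ) : ℂ :=
  -((σ ^ 2 * ξ ^ 2 : ℝ) : ℂ) +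
    ∫ x : ℝ, (Complex.exp (ξ * x * Complex.I) - 1 - ξ * x * Complex.I) * Real.exp (-w * x) ∂ν

lemma norm_exp_mul_I_sub_le (y : ℝ) :
    ‖Complex.exp (y * Complex.I) - 1 - y * Complex.I‖ ≤ 3 * y ^ 2 := by
  have h := norm_exp_sub_one_sub_le (u := y * Complex.I) (by simp)
  rwa [norm_mul, Complex.norm_I, mul_one, Complex.norm_real, Real.norm_eq_abs, sq_abs] at h

lemma norm_exp_mul_I_sub_sub_le (y : ℝ) :
    ‖Complex.exp (y * Complex.I) - 1 - y * Complex.I + (y : ℂ) ^ 2 / 2‖ ≤ 4 * |y| ^ 3 := by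
  have hn : ‖(y : ℂ) * Complex.I‖ = |y| := by
    rw [norm_mul, Complex.norm_I, mul_one, Complex.norm_real, Real.norm_eq_abs]
  have h0 := abs_nonneg y
  rcases le_total |y| 1 with h | h
  · have h1 := Complex.exp_bound (x := y * Complex.I) (by rw [hn]; exact h) (n := 3) (by norm_num)
    rw [hn] at h1
    have e : Complex.exp (y * Complex.I) - 1 - y * Complex.I + (y : ℂ) ^ 2 / 2 =
        Complex.exp (y * Complex.I) - ∑ m ∈ Finset.range 3, (y * Complex.I) ^ m / (m.factorial : ℂ) := by
      simp [Finset.sum_range_succ, mul_pow, Nat.factorial]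
      ring
    rw [e]
    refine h1.trans ?_
    rw [mul_comm]
    refine mul_le_mul_of_nonneg_right ?_ (by positivity)
    norm_num [Nat.factorial]
  · have h1 := norm_exp_mul_I_sub_le y
    have h2 : ‖(y : ℂ) ^ 2 / 2‖ = y ^ 2 / 2 := by
      rw [norm_div, norm_pow, Complex.norm_real, Real.norm_eq_abs, sq_abs]; simp
    refine (norm_add_le _ _).trans ?_
    rw [h2]
    have : y ^ 2 ≤ |y| ^ 3 := by rw [← sq_abs, pow_succ |y| 2]; nlinarith [sq_nonneg |y|]
    linarith [sq_nonneg y]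

/-- Any constant up to `1/2 - 5/96` would do, `5/96` being the quartic error of `Real.cos_bound`. -/
lemma sq_div_five_le_one_sub_cos {y : ℝ} (hy : |y| ≤ 1) : y ^ 2 / 5 ≤ 1 - Real.cos y := by
  have h := (abs_le.1 (Real.cos_bound hy)).2
  have h1 : |y| ^ 4 ≤ y ^ 2 := by
    rw [← sq_abs y]
    exact pow_le_pow_of_le_one (abs_nonneg y) hy (by norm_num)
  linarith [sq_nonneg y]

section
variable {ν : Measure ℝ} (hν : IsPositiveLevyMeasure ν)
include hν

lemma integrable_tiltedExponent {w : ℝ} (hw : 0 < w) (ξ : ℝ) :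
    Integrable (fun x : ℝ => (Complex.exp (ξ * x * Complex.I) - 1 - ξ * x * Complex.I) *
      Real.exp (-w * x)) ν := by
  refine ((hν.integrable_sq_mul_exp hw).const_mul (3 * ξ ^ 2)).mono' (by fun_prop)
    (ae_of_all _ fun x => ?_)
  rw [norm_mul, Complex.norm_real, Real.norm_of_nonneg (Real.exp_pos _).le]
  have := norm_exp_mul_I_sub_le (ξ * x)
  push_cast at this
  have h2 := mul_le_mul_of_nonneg_right this (Real.exp_pos (-w * x)).le
  linarith [h2]

/-- Subtracting the first-order Taylor polynomial at `w` cancels the drift `b` and the cutoff at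
`1`; the remaining integral is compensated at every jump size, with jump measure `e^{-wx}ν(dx)`. -/
lemma complexExponent_sub (σ b : ℝ) {w : ℝ} (hw : 0 < w) (ξ : ℝ) :
    complexExponent σ b ν (w - ξ * Complex.I) - realExponent σ b ν w +
      ξ * Complex.I * realExponentDeriv σ b ν w = tiltedExponent σ ν w ξ := by
  have h1 : Integrable (levyKernel (w - ξ * Complex.I)) ν :=
    hν.integrable_levyKernel (by simp [hw.le])
  have h2 := hν.integrable_realKernel hw.le
  have h3 := hν.integrable_indicator_sub_mul_exp hw
  have h2' : Integrable (fun x : ℝ => ((Real.exp (-w * x) - 1 +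
      w * (Iio (1 : ℝ)).indicator (fun y : ℝ => y) x : ℝ) : ℂ)) ν := h2.ofReal
  have h3' : Integrable (fun x : ℝ => ξ * Complex.I *
      (((Iio (1 : ℝ)).indicator (fun y : ℝ => y) x - x * Real.exp (-w * x) : ℝ) : ℂ)) ν :=
    h3.ofReal.const_mul _
  have h12 : Integrable (fun x : ℝ => levyKernel (w - ξ * Complex.I) x -
      ((Real.exp (-w * x) - 1 + w * (Iio (1 : ℝ)).indicator (fun y : ℝ => y) x : ℝ) : ℂ)) ν :=
    h1.sub h2'
  have key : (∫ x, levyKernel (w - ξ * Complex.I) x ∂ν) -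
      ((∫ x : ℝ, (Real.exp (-w * x) - 1 + w * (Iio (1 : ℝ)).indicator (fun y : ℝ => y) x) ∂ν : ℝ)
        : ℂ) +
      ξ * Complex.I * ((∫ x : ℝ, ((Iio (1 : ℝ)).indicator (fun y : ℝ => y) x -
        x * Real.exp (-w * x)) ∂ν : ℝ) : ℂ) =
      ∫ x : ℝ, (Complex.exp (ξ * x * Complex.I) - 1 - ξ * x * Complex.I) *
        Real.exp (-w * x) ∂ν := by
    rw [← integral_complex_ofReal, ← integral_complex_ofReal, ← integral_const_mul,
      ← integral_sub h1 h2', ← integral_add h12 h3']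
    congr 1; ext x
    have e : Complex.exp (-(w - ξ * Complex.I) * x) =
        Complex.exp (ξ * x * Complex.I) * (Real.exp (-w * x) : ℂ) := by
      rw [Complex.ofReal_exp, ← Complex.exp_add]
      push_cast; ring_nf
    unfold levyKernel
    by_cases h : x ∈ Iio (1 : ℝ)
    · simp only [indicator_of_mem h]
      rw [e]; push_cast; ring
    · simp only [indicator_of_notMem h]
      rw [e]; push_cast; ring
  unfold complexExponent realExponent realExponentDeriv tiltedExponent
  rw [← key]
  push_cast
  linear_combination (σ : ℂ) ^ 2 * (ξ : ℂ) ^ 2 * Complex.I_sq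

lemma re_tiltedExponent (σ : ℝ) {w : ℝ} (hw : 0 < w) (ξ : ℝ) :
    Integrable (fun x : ℝ => (1 - Real.cos (ξ * x)) * Real.exp (-w * x)) ν ∧
    (tiltedExponent σ ν w ξ).re =
      -(σ ^ 2 * ξ ^ 2 + ∫ x : ℝ, (1 - Real.cos (ξ * x)) * Real.exp (-w * x) ∂ν) := by
  have h := integrable_tiltedExponent hν hw ξ
  have e : ∀ x : ℝ, RCLike.re ((Complex.exp (ξ * x * Complex.I) - 1 - ξ * x * Complex.I) *
      Real.exp (-w * x)) = -((1 - Real.cos (ξ * x)) * Real.exp (-w * x)) := by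
    intro x
    have h1 : (Complex.exp (ξ * x * Complex.I)).re = Real.cos (ξ * x) := by
      rw [← Complex.ofReal_mul, Complex.exp_ofReal_mul_I_re]
    rw [← Complex.ofReal_mul] at h1 ⊢
    change Complex.re _ = _
    rw [Complex.re_mul_ofReal, Complex.sub_re, Complex.sub_re, h1]
    simp
    ring
  constructor
  · have := h.re.neg
    refine this.congr (ae_of_all _ fun x => ?_)
    simp only [Pi.neg_apply]
    rw [e, neg_neg]
  · have h2 := integral_re h
    simp_rw [e] at h2
    rw [integral_neg] at h2
    unfold tiltedExponent
    rw [Complex.add_re, Complex.neg_re, Complex.ofReal_re]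
    have h3 : (∫ x : ℝ, (Complex.exp (ξ * x * Complex.I) - 1 - ξ * x * Complex.I) *
        Real.exp (-w * x) ∂ν).re = _ := h2.symm
    rw [h3]; ring

/-- Gaussian lower bound for the decay of the tilted characteristic function, in terms of the
second moment of the jumps of size at most `1 / s`. -/
lemma le_neg_re_tiltedExponent (σ : ℝ) {w s ξ : ℝ} (hw : 0 < w) (hws : w ≤ s) (hξ : |ξ| ≤ s) :
    ξ ^ 2 / 5 * (2 * σ ^ 2 + ∫ x in Iic (1 / s), x ^ 2 * Real.exp (-s * x) ∂ν) ≤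
      -(tiltedExponent σ ν w ξ).re := by
  have hs : 0 < s := hw.trans_le hws
  obtain ⟨hi, hre⟩ := re_tiltedExponent hν σ hw ξ
  rw [hre, neg_neg, mul_add, ← integral_const_mul]
  refine add_le_add (by nlinarith [mul_nonneg (sq_nonneg σ) (sq_nonneg ξ)]) ?_
  rw [← integral_indicator measurableSet_Iic]
  refine integral_mono_ae (((hν.integrable_sq_mul_exp hs).const_mul _).indicator measurableSet_Iic)
    hi ?_
  filter_upwards [hν.ae_pos] with x hx
  have hcos := Real.cos_le_one (ξ * x)
  by_cases h : x ∈ Iic (1 / s)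
  · rw [indicator_of_mem h]
    have hx1 : x ≤ 1 / s := h
    rw [le_div_iff₀ hs] at hx1
    have h1 := sq_div_five_le_one_sub_cos (y := ξ * x) (by
      rw [abs_mul, abs_of_pos hx]; nlinarith)
    have h2 : Real.exp (-s * x) ≤ Real.exp (-w * x) := Real.exp_le_exp.2 (by nlinarith)
    calc ξ ^ 2 / 5 * (x ^ 2 * Real.exp (-s * x)) = (ξ * x) ^ 2 / 5 * Real.exp (-s * x) := by ring
      _ ≤ _ := by gcongr
  · rw [indicator_of_notMem h]
    exact mul_nonneg (by linarith) (Real.exp_pos _).le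

/-- The third-order remainder involves `x³e^{-wx}`. One factor `x` is absorbed by half of the
exponential at the cost of `2/w`, leaving `x²e^{-wx/2}`; this is why the second derivative appears
at `w/2`. -/
lemma norm_tiltedExponent_add_le (σ : ℝ) {w : ℝ} (hw : 0 < w) (ξ : ℝ) :
    ‖tiltedExponent σ ν w ξ + ((realExponentDeriv2 σ ν w * ξ ^ 2 / 2 : ℝ) : ℂ)‖ ≤
      8 * |ξ| ^ 3 / w * realExponentDeriv2 σ ν (w / 2) := by
  have h1 := integrable_tiltedExponent hν hw ξ
  have h2 := hν.integrable_sq_mul_exp hw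
  have h3 := hν.integrable_sq_mul_exp (half_pos hw)
  have e : tiltedExponent σ ν w ξ + ((realExponentDeriv2 σ ν w * ξ ^ 2 / 2 : ℝ) : ℂ) =
      ∫ x : ℝ, (Complex.exp (ξ * x * Complex.I) - 1 - ξ * x * Complex.I + (ξ * x : ℂ) ^ 2 / 2) *
        Real.exp (-w * x) ∂ν := by
    have h4 : (∫ x : ℝ, (Complex.exp (ξ * x * Complex.I) - 1 - ξ * x * Complex.I) *
        Real.exp (-w * x) ∂ν) + (ξ : ℂ) ^ 2 / 2 * ((∫ x : ℝ, x ^ 2 * Real.exp (-w * x) ∂ν : ℝ) : ℂ)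
        = ∫ x : ℝ, (Complex.exp (ξ * x * Complex.I) - 1 - ξ * x * Complex.I +
          (ξ * x : ℂ) ^ 2 / 2) * Real.exp (-w * x) ∂ν := by
      have h2' : Integrable (fun x : ℝ => (ξ : ℂ) ^ 2 / 2 *
          ((x ^ 2 * Real.exp (-w * x) : ℝ) : ℂ)) ν := h2.ofReal.const_mul _
      rw [← integral_complex_ofReal, ← integral_const_mul, ← integral_add h1 h2']
      congr 1; ext x
      push_cast; ring
    rw [← h4]
    unfold tiltedExponent realExponentDeriv2
    push_cast; ring
  rw [e]
  have hb : ∀ᵐ x : ℝ ∂ν, ‖(Complex.exp (ξ * x * Complex.I) - 1 - ξ * x * Complex.I +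
      (ξ * x : ℂ) ^ 2 / 2) * (Real.exp (-w * x) : ℂ)‖ ≤
        8 * |ξ| ^ 3 / w * (x ^ 2 * Real.exp (-(w / 2) * x)) := by
    filter_upwards [hν.ae_pos] with x hx
    rw [norm_mul, Complex.norm_real, Real.norm_of_nonneg (Real.exp_pos _).le]
    have h := norm_exp_mul_I_sub_sub_le (ξ * x)
    push_cast at h
    rw [abs_mul, abs_of_pos hx] at h
    have h5 : w / 2 * x * Real.exp (-(w / 2) * x) ≤ 1 := by
      have h6 := Real.add_one_le_exp (w / 2 * x)
      have h7 : Real.exp (w / 2 * x) * Real.exp (-(w / 2) * x) = 1 := by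
        rw [← Real.exp_add]; simp
      nlinarith [Real.exp_pos (-(w / 2) * x)]
    have h8 : Real.exp (-w * x) = Real.exp (-(w / 2) * x) * Real.exp (-(w / 2) * x) := by
      rw [← Real.exp_add]; ring_nf
    calc _ ≤ 4 * (|ξ| * x) ^ 3 * Real.exp (-w * x) := by gcongr
      _ = 8 * |ξ| ^ 3 / w * (x ^ 2 * Real.exp (-(w / 2) * x)) *
          (w / 2 * x * Real.exp (-(w / 2) * x)) := by rw [h8]; field_simp; ring
      _ ≤ 8 * |ξ| ^ 3 / w * (x ^ 2 * Real.exp (-(w / 2) * x)) * 1 := by gcongr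
      _ = _ := mul_one _
  refine (norm_integral_le_of_norm_le (h3.const_mul _) hb).trans ?_
  rw [integral_const_mul]
  refine mul_le_mul_of_nonneg_left ?_ (by positivity)
  unfold realExponentDeriv2
  nlinarith [sq_nonneg σ]

/-! ### Consequences of lower scaling. -/

/-- Under lower scaling of the second derivative of the Laplace exponent, the truncated second
moment of the jumps is comparable with it. -/
lemma exists_le_truncated_second_moment {σ α c x₀ : ℝ} (hc : 0 < c) (hx₀ : 0 ≤ x₀)
    (hscal : WLSC (realExponentDeriv2 σ ν) (α - 2) c x₀) :
    ∃ κ : ℝ, 0 < κ ∧ ∀ s : ℝ, x₀ < s → κ * realExponentDeriv2 σ ν s ≤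
      2 * σ ^ 2 + ∫ x in Iic (1 / s), x ^ 2 * Real.exp (-s * x) ∂ν := by
  have hq : 0 < c * (2 : ℝ) ^ (α - 2) / 2 := by positivity
  -- At the argument `Ks`, jumps above `1/s` contribute at most `e^{-K/2} φ''(Ks/2)`, and scaling by
  -- `2` bounds `φ''(Ks/2)` by `φ''(Ks) / (c 2^{α-2})`. This `K` makes the contribution at most half
  -- of `φ''(Ks)`; `K ≥ 2` keeps `Ks/2` above `x₀`.
  obtain ⟨K, hK2, hK⟩ : ∃ K : ℝ, 2 ≤ K ∧ Real.exp (-(K / 2)) ≤ c * (2 : ℝ) ^ (α - 2) / 2 := by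
    have h1 : Tendsto (fun K : ℝ => Real.exp (-(K / 2))) atTop (𝓝 0) :=
      Real.tendsto_exp_neg_atTop_nhds_zero.comp (tendsto_id.atTop_div_const two_pos)
    obtain ⟨K, h⟩ := ((h1.eventually_lt_const hq).and (eventually_ge_atTop 2)).exists
    exact ⟨K, h.2, h.1.le⟩
  refine ⟨c * K ^ (α - 2) / 2, by positivity, fun s hs => ?_⟩
  have hs0 : 0 < s := hx₀.trans_lt hs
  have hθ : 0 < K * s := by positivity
  have hi := hν.integrable_sq_mul_exp hθ
  have hi2 := hν.integrable_sq_mul_exp (half_pos hθ)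
  have hsplit : realExponentDeriv2 σ ν (K * s) = 2 * σ ^ 2 +
      ((∫ x in Iic (1 / s), x ^ 2 * Real.exp (-(K * s) * x) ∂ν) +
        ∫ x in Ioi (1 / s), x ^ 2 * Real.exp (-(K * s) * x) ∂ν) := by
    rw [← compl_Iic, integral_add_compl measurableSet_Iic hi]
    rfl
  have hsmall : ∫ x in Iic (1 / s), x ^ 2 * Real.exp (-(K * s) * x) ∂ν ≤
      ∫ x in Iic (1 / s), x ^ 2 * Real.exp (-s * x) ∂ν := by
    refine integral_mono_ae hi.integrableOn (hν.integrable_sq_mul_exp hs0).integrableOn ?_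
    filter_upwards [ae_restrict_of_ae hν.ae_pos] with x hx
    have : s ≤ K * s := by nlinarith
    gcongr
  have hlarge : ∫ x in Ioi (1 / s), x ^ 2 * Real.exp (-(K * s) * x) ∂ν ≤
      Real.exp (-(K / 2)) * realExponentDeriv2 σ ν (K * s / 2) := by
    calc ∫ x in Ioi (1 / s), x ^ 2 * Real.exp (-(K * s) * x) ∂ν
        ≤ ∫ x in Ioi (1 / s), Real.exp (-(K / 2)) * (x ^ 2 * Real.exp (-(K * s / 2) * x)) ∂ν := by
          refine setIntegral_mono_on hi.integrableOn (hi2.const_mul _).integrableOn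
            measurableSet_Ioi fun x hx => ?_
          have hx1 : 1 / s < x := hx
          rw [div_lt_iff₀ hs0] at hx1
          have : Real.exp (-(K * s) * x) ≤ Real.exp (-(K / 2)) * Real.exp (-(K * s / 2) * x) := by
            rw [← Real.exp_add]
            exact Real.exp_le_exp.2 (by nlinarith)
          nlinarith [sq_nonneg x]
      _ ≤ ∫ x, Real.exp (-(K / 2)) * (x ^ 2 * Real.exp (-(K * s / 2) * x)) ∂ν :=
          setIntegral_le_integral (hi2.const_mul _) (ae_of_all _ fun x => by positivity)
      _ = Real.exp (-(K / 2)) * ∫ x, (x ^ 2 * Real.exp (-(K * s / 2) * x)) ∂ν :=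
          integral_const_mul _ _
      _ ≤ _ := by
          refine mul_le_mul_of_nonneg_left ?_ (Real.exp_pos _).le
          unfold realExponentDeriv2
          nlinarith [sq_nonneg σ]
  have hhalf := hscal 2 one_le_two (K * s / 2) (by nlinarith)
  rw [mul_div_cancel₀ _ (two_ne_zero' ℝ)] at hhalf
  have hKs := hscal K (by linarith) s hs
  have h0 := realExponentDeriv2_nonneg (ν := ν) σ (K * s / 2)
  have h1 := mul_le_mul_of_nonneg_right hK h0
  linarith

/-- Doubling property of the second derivative of the Laplace exponent. -/
lemma exists_le_mul_of_half {σ α c x₀ : ℝ} (hc : 0 < c) (hx₀ : 0 ≤ x₀)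
    (hpos : ∀ l : ℝ, 0 < l → 0 < realExponentDeriv2 σ ν l)
    (hscal : WLSC (realExponentDeriv2 σ ν) (α - 2) c x₀) :
    ∃ D : ℝ, 0 < D ∧ ∀ w : ℝ, x₀ < w →
      realExponentDeriv2 σ ν (w / 2) ≤ D * realExponentDeriv2 σ ν w := by
  have hq : 0 < c * (2 : ℝ) ^ (α - 2) := by positivity
  -- The first summand serves `w/2 > x₀`, where scaling applies. The second serves `x₀ < w ≤ 2x₀`,
  -- where only monotonicity is available; that range is empty if `x₀ = 0`.
  refine ⟨(c * (2 : ℝ) ^ (α - 2))⁻¹ +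
    realExponentDeriv2 σ ν (x₀ / 2) / realExponentDeriv2 σ ν (2 * x₀), ?_, fun w hw => ?_⟩
  · exact add_pos_of_pos_of_nonneg (inv_pos.2 hq)
      (div_nonneg (realExponentDeriv2_nonneg _ _) (realExponentDeriv2_nonneg _ _))
  have hw0 : 0 < w := hx₀.trans_lt hw
  have hfw := hpos w hw0
  rw [add_mul]
  rcases lt_or_ge x₀ (w / 2) with h | h
  · have h1 := hscal 2 one_le_two (w / 2) h
    rw [mul_div_cancel₀ _ (two_ne_zero' ℝ)] at h1
    have h2 : realExponentDeriv2 σ ν (w / 2) ≤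
        (c * (2 : ℝ) ^ (α - 2))⁻¹ * realExponentDeriv2 σ ν w := by
      rw [inv_mul_eq_div, le_div_iff₀ hq]; linarith
    have h3 : 0 ≤ realExponentDeriv2 σ ν (x₀ / 2) / realExponentDeriv2 σ ν (2 * x₀) :=
      div_nonneg (realExponentDeriv2_nonneg _ _) (realExponentDeriv2_nonneg _ _)
    nlinarith
  · have hx : 0 < x₀ := by linarith
    have h1 := realExponentDeriv2_antitoneOn hν σ (half_pos hx) (half_pos hw0)
      (by linarith : x₀ / 2 ≤ w / 2)
    have h2 := realExponentDeriv2_antitoneOn hν σ hw0 (by positivity : (0 : ℝ) < 2 * x₀)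
      (by linarith : w ≤ 2 * x₀)
    have h3 := hpos (2 * x₀) (by positivity)
    have h4 : realExponentDeriv2 σ ν (x₀ / 2) ≤ realExponentDeriv2 σ ν (x₀ / 2) /
        realExponentDeriv2 σ ν (2 * x₀) * realExponentDeriv2 σ ν w := by
      rw [div_mul_eq_mul_div, le_div_iff₀ h3]
      exact mul_le_mul_of_nonneg_left h2 (realExponentDeriv2_nonneg _ _)
    have : 0 ≤ (c * (2 : ℝ) ^ (α - 2))⁻¹ * realExponentDeriv2 σ ν w := by positivity
    linarith

end

/-- Serves to replace `α` by `min α 2`, so that the scaling exponent `α - 2` is nonpositive in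
`exists_majorant`. -/
lemma WLSC.mono_exponent {f : ℝ → ℝ} {a a' c x₁ : ℝ} (h : WLSC f a c x₁) (ha : a' ≤ a)
    (hc : 0 ≤ c) (hf : ∀ x, 0 ≤ f x) : WLSC f a' c x₁ := by
  intro l hl x hx
  refine le_trans ?_ (h l hl x hx)
  have := Real.rpow_le_rpow_of_exponent_le hl ha
  have := hf x
  gcongr

lemma integrable_exp_neg_mul_abs_rpow {α a : ℝ} (hα : 0 < α) (ha : 0 < a) :
    Integrable fun v : ℝ => Real.exp (-a * |v| ^ α) := by
  have h := integrableOn_rpow_mul_exp_neg_mul_rpow (s := 0) (by norm_num) hα ha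
  simp only [Real.rpow_zero, one_mul] at h
  have h1 : IntegrableOn (fun v : ℝ => Real.exp (-a * |v| ^ α)) (Ioi 0) :=
    h.congr_fun (fun v hv => by rw [abs_of_pos (mem_Ioi.1 hv)]) measurableSet_Ioi
  have h2 : IntegrableOn (fun v : ℝ => Real.exp (-a * |v| ^ α)) (Iic 0) := by
    rw [← Measure.map_neg_eq_self (volume : Measure ℝ)]
    have m : MeasurableEmbedding fun x : ℝ => -x := (Homeomorph.neg ℝ).measurableEmbedding
    rw [m.integrableOn_map_iff]
    simp_rw [Function.comp_def, abs_neg, neg_preimage, neg_Iic, neg_zero]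
    exact Iff.mpr integrableOn_Ici_iff_integrableOn_Ioi h1
  rw [← integrableOn_univ, ← Iic_union_Ioi (a := (0 : ℝ))]
  exact h2.union h1

section
variable {ν : Measure ℝ} (hν : IsPositiveLevyMeasure ν)
include hν

lemma continuous_tiltedExponent (σ : ℝ) {w : ℝ} (hw : 0 < w) :
    Continuous (tiltedExponent σ ν w) := by
  unfold tiltedExponent
  refine Continuous.add (by fun_prop) (continuous_iff_continuousAt.2 fun ξ₀ => ?_)
  refine continuousAt_of_dominated
    (bound := fun x => 3 * (|ξ₀| + 1) ^ 2 * (x ^ 2 * Real.exp (-w * x)))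
    (Eventually.of_forall fun ξ => (integrable_tiltedExponent hν hw ξ).aestronglyMeasurable) ?_
    ((hν.integrable_sq_mul_exp hw).const_mul _) (ae_of_all _ fun x => by fun_prop)
  have hev : ∀ᶠ ξ : ℝ in 𝓝 ξ₀, |ξ| < |ξ₀| + 1 :=
    (continuous_abs.tendsto ξ₀).eventually_lt_const (by linarith)
  filter_upwards [hev] with ξ hξ
  refine ae_of_all _ fun x => ?_
  rw [norm_mul, Complex.norm_real, Real.norm_of_nonneg (Real.exp_pos _).le]
  have := norm_exp_mul_I_sub_le (ξ * x)
  push_cast at this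
  have h1 : ξ ^ 2 ≤ (|ξ₀| + 1) ^ 2 := by
    rw [← sq_abs ξ]; gcongr
  calc _ ≤ 3 * (ξ * x) ^ 2 * Real.exp (-w * x) := by gcongr
    _ = 3 * ξ ^ 2 * (x ^ 2 * Real.exp (-w * x)) := by ring
    _ ≤ _ := by gcongr

/-- Decay of the tilted exponent under lower scaling. -/
lemma exists_decay_tiltedExponent {σ α c x₀ : ℝ} (hc : 0 < c) (hc1 : c ≤ 1) (hx₀ : 0 ≤ x₀)
    (hscal : WLSC (realExponentDeriv2 σ ν) (α - 2) c x₀) :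
    ∃ a : ℝ, 0 < a ∧ ∀ w : ℝ, x₀ < w → ∀ ξ : ℝ,
      (|ξ| ≤ w → a * realExponentDeriv2 σ ν w * ξ ^ 2 ≤ -(tiltedExponent σ ν w ξ).re) ∧
      (w < |ξ| → a * realExponentDeriv2 σ ν w * (ξ ^ 2 * (|ξ| / w) ^ (α - 2)) ≤
        -(tiltedExponent σ ν w ξ).re) := by
  obtain ⟨κ, hκ, h⟩ := exists_le_truncated_second_moment hν hc hx₀ hscal
  -- The truncation level is `1 / max(w, |ξ|)`. The factor `c` pays for scaling from `w` to `|ξ|`;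
  -- for `|ξ| ≤ w` it is simply dropped using `c ≤ 1`.
  refine ⟨κ * c / 5, by positivity, fun w hw ξ => ⟨fun hξ => ?_, fun hξ => ?_⟩⟩
  · have hw0 : 0 < w := hx₀.trans_lt hw
    have h1 := le_neg_re_tiltedExponent hν σ hw0 le_rfl hξ
    have h2 := mul_le_mul_of_nonneg_left (h w hw) (by positivity : 0 ≤ ξ ^ 2 / 5)
    have h3 : 0 ≤ κ * realExponentDeriv2 σ ν w * ξ ^ 2 := by
      have := realExponentDeriv2_nonneg (ν := ν) σ w
      positivity
    nlinarith
  · have hw0 : 0 < w := hx₀.trans_lt hw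
    have h1 := le_neg_re_tiltedExponent hν σ hw0 hξ.le (le_refl |ξ|)
    have h2 := mul_le_mul_of_nonneg_left (h |ξ| (hw.trans hξ)) (by positivity : 0 ≤ ξ ^ 2 / 5)
    have h3 := hscal (|ξ| / w) ((one_le_div hw0).2 hξ.le) w hw
    rw [div_mul_cancel₀ _ hw0.ne'] at h3
    have h4 := mul_le_mul_of_nonneg_left h3 (by positivity : 0 ≤ ξ ^ 2 / 5 * κ)
    linarith

lemma integrable_exp_mul_tiltedExponent {σ α c x₀ : ℝ} (hα : 0 < α) (hc : 0 < c) (hc1 : c ≤ 1)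
    (hx₀ : 0 ≤ x₀) (hpos : ∀ l : ℝ, 0 < l → 0 < realExponentDeriv2 σ ν l)
    (hscal : WLSC (realExponentDeriv2 σ ν) (α - 2) c x₀) {t w : ℝ} (ht : 0 < t) (hw : x₀ < w) :
    Integrable fun ξ : ℝ => Complex.exp (t * tiltedExponent σ ν w ξ) := by
  obtain ⟨a, ha, h⟩ := exists_decay_tiltedExponent hν hc hc1 hx₀ hscal
  have hw0 : 0 < w := hx₀.trans_lt hw
  have hfw := hpos w hw0
  set β := t * a * realExponentDeriv2 σ ν w * w ^ (2 - α) with hβ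
  have hβ0 : 0 < β := by positivity
  have hcont := continuous_tiltedExponent hν σ hw0
  -- The factor `e^{βw^α}` makes the majorant at least `1` on `|ξ| ≤ w`, so only the range `|ξ| > w`
  -- uses the decay.
  refine ((integrable_exp_neg_mul_abs_rpow hα hβ0).const_mul (Real.exp (β * w ^ α))).mono'
    (by fun_prop) (ae_of_all _ fun ξ => ?_)
  rw [Complex.norm_exp, Complex.re_ofReal_mul, ← Real.exp_add]
  refine Real.exp_le_exp.2 ?_
  have hwα : 0 < w ^ α := Real.rpow_pos_of_pos hw0 _
  rcases le_or_gt |ξ| w with hξ | hξ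
  · have h1 := (h w hw ξ).1 hξ
    have h2 : |ξ| ^ α ≤ w ^ α := Real.rpow_le_rpow (abs_nonneg _) hξ hα.le
    have h3 : 0 ≤ a * realExponentDeriv2 σ ν w * ξ ^ 2 := by positivity
    nlinarith
  · have h1 := (h w hw ξ).2 hξ
    have hξ0 : 0 < |ξ| := hw0.trans hξ
    have h2 : ξ ^ 2 * (|ξ| / w) ^ (α - 2) = w ^ (2 - α) * |ξ| ^ α := by
      rw [Real.div_rpow hξ0.le hw0.le, Real.rpow_sub hξ0, Real.rpow_sub hw0, Real.rpow_sub hw0,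
        Real.rpow_two, Real.rpow_two, sq_abs]
      have : ξ ≠ 0 := abs_pos.1 hξ0
      field_simp
    rw [h2] at h1
    have h3 := mul_le_mul_of_nonneg_left h1 ht.le
    have h4 : 0 < β * w ^ α := by positivity
    have h5 : t * (a * realExponentDeriv2 σ ν w * (w ^ (2 - α) * |ξ| ^ α)) = β * |ξ| ^ α := by
      rw [hβ]; ring
    linarith

/-- After rescaling by the standard deviation, the tilted characteristic function has an
integrable majorant which does not depend on the time and on the tilting parameter. -/
lemma exists_majorant {σ α c x₀ : ℝ} (hα : 0 < α) (hα2 : α ≤ 2) (hc : 0 < c) (hc1 : c ≤ 1)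
    (hx₀ : 0 ≤ x₀) (hpos : ∀ l : ℝ, 0 < l → 0 < realExponentDeriv2 σ ν l)
    (hscal : WLSC (realExponentDeriv2 σ ν) (α - 2) c x₀) :
    ∃ G : ℝ → ℝ, Integrable G ∧ (∀ v, 0 ≤ G v) ∧ ∀ t w : ℝ, 0 < t → x₀ < w →
      1 ≤ t * w ^ 2 * realExponentDeriv2 σ ν w → ∀ v : ℝ,
        ‖Complex.exp (t * tiltedExponent σ ν w (v / √(t * realExponentDeriv2 σ ν w)))‖ ≤ G v := by
  obtain ⟨a, ha, h⟩ := exists_decay_tiltedExponent hν hc hc1 hx₀ hscal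
  -- The two terms match the regimes `|v/s| ≤ w` and `|v/s| > w`.
  refine ⟨fun v => Real.exp (-a * |v| ^ (2 : ℝ)) + Real.exp (-a * |v| ^ α),
    (integrable_exp_neg_mul_abs_rpow two_pos ha).add (integrable_exp_neg_mul_abs_rpow hα ha),
    fun v => by positivity, fun t w ht hw hA v => ?_⟩
  have hw0 : 0 < w := hx₀.trans_lt hw
  have hfw := hpos w hw0
  set s := √(t * realExponentDeriv2 σ ν w) with hs
  have hs0 : 0 < s := Real.sqrt_pos.2 (by positivity)
  have hs2 : s ^ 2 = t * realExponentDeriv2 σ ν w := Real.sq_sqrt (by positivity)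
  have hsw : 1 ≤ s * w := by
    have : 1 ≤ (s * w) ^ 2 := by rw [mul_pow, hs2]; linarith
    nlinarith [mul_pos hs0 hw0]
  have hsq : t * (a * realExponentDeriv2 σ ν w * (v / s) ^ 2) = a * |v| ^ 2 := by
    rw [div_pow, hs2, sq_abs]; field_simp
  rw [Complex.norm_exp, Complex.re_ofReal_mul]
  simp only [Real.rpow_two]
  rcases le_or_gt |v / s| w with hξ | hξ
  · refine le_add_of_le_of_nonneg (Real.exp_le_exp.2 ?_) (Real.exp_pos _).le
    have h1 := mul_le_mul_of_nonneg_left ((h w hw (v / s)).1 hξ) ht.le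
    linarith
  · refine le_add_of_nonneg_of_le (Real.exp_pos _).le (Real.exp_le_exp.2 ?_)
    have h1 := mul_le_mul_of_nonneg_left ((h w hw (v / s)).2 hξ) ht.le
    rw [abs_div, abs_of_pos hs0] at h1 hξ
    have hv : 0 < |v| := by
      have := hw0.trans hξ
      by_contra hv
      rw [le_antisymm (not_lt.1 hv) (abs_nonneg v)] at this
      simp at this
    -- Since `sw ≥ 1` and `α ≤ 2`, dropping the division by `sw` only lowers the power; this removes
    -- the dependence on `t` and `w`.
    have h2 : |v| ^ (α - 2) ≤ (|v| / s / w) ^ (α - 2) := by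
      refine Real.rpow_le_rpow_of_nonpos (by positivity) ?_ (by linarith)
      rw [div_div]
      exact div_le_self hv.le hsw
    have h3 : |v| ^ α = |v| ^ 2 * |v| ^ (α - 2) := by
      rw [← Real.rpow_two, ← Real.rpow_add hv]; ring_nf
    have h4 := mul_le_mul_of_nonneg_left h2 (by positivity : 0 ≤ a * |v| ^ 2)
    have h5 : t * (a * realExponentDeriv2 σ ν w * ((v / s) ^ 2 * (|v| / s / w) ^ (α - 2))) =
        a * |v| ^ 2 * (|v| / s / w) ^ (α - 2) := by rw [← hsq]; ring
    rw [h3]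
    linarith

end

/-! ### Two-sided bounds for the saddle-point integral. -/

/-- Perturbation of the standard Gaussian exponent by a small error. -/
lemma quarter_le_re_exp {v : ℝ} {E : ℂ} (hE : ‖E‖ ≤ 1 / 4) :
    0 ≤ (Complex.exp (((-(v ^ 2 / 2) : ℝ) : ℂ) + E)).re ∧
      (|v| ≤ 1 → 1 / 4 ≤ (Complex.exp (((-(v ^ 2 / 2) : ℝ) : ℂ) + E)).re) := by
  have h1 : 1 / 2 ≤ (Complex.exp E).re := by
    have h2 := Complex.norm_exp_sub_one_le (x := E) (by linarith)
    have h3 := (abs_le.1 (Complex.abs_re_le_norm (Complex.exp E - 1))).1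
    rw [Complex.sub_re, Complex.one_re] at h3
    linarith
  rw [Complex.exp_add, ← Complex.ofReal_exp, Complex.re_ofReal_mul]
  refine ⟨by positivity, fun hv => ?_⟩
  have h2 : (1 : ℝ) / 2 ≤ Real.exp (-(v ^ 2 / 2)) := by
    have h3 := Real.add_one_le_exp (-(v ^ 2 / 2))
    have h4 : v ^ 2 ≤ 1 := (sq_le_one_iff_abs_le_one v).2 hv
    linarith
  nlinarith

section
variable {ν : Measure ℝ} (hν : IsPositiveLevyMeasure ν)
include hν

/-- Two-sided bounds for the Fourier integral of the tilted characteristic function. -/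
theorem exists_bounds_integral_tiltedExponent {σ α c x₀ : ℝ} (hα : 0 < α) (hα2 : α ≤ 2)
    (hc : 0 < c) (hc1 : c ≤ 1) (hx₀ : 0 ≤ x₀)
    (hpos : ∀ l : ℝ, 0 < l → 0 < realExponentDeriv2 σ ν l)
    (hscal : WLSC (realExponentDeriv2 σ ν) (α - 2) c x₀) :
    ∃ M₀ : ℝ, 0 < M₀ ∧ ∃ C : ℝ, 1 ≤ C ∧ ∀ t w : ℝ, 0 < t → x₀ < w →
      M₀ < t * w ^ 2 * realExponentDeriv2 σ ν w →
        C⁻¹ * (√(t * realExponentDeriv2 σ ν w))⁻¹ ≤ (2 * Real.pi)⁻¹ *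
          (∫ ξ : ℝ, Complex.exp (t * tiltedExponent σ ν w ξ)).re ∧
        (2 * Real.pi)⁻¹ * (∫ ξ : ℝ, Complex.exp (t * tiltedExponent σ ν w ξ)).re ≤
          C * (√(t * realExponentDeriv2 σ ν w))⁻¹ := by
  obtain ⟨G, hGi, hG0, hG⟩ := exists_majorant hν hα hα2 hc hc1 hx₀ hpos hscal
  obtain ⟨D, hD, hDw⟩ := exists_le_mul_of_half hν hc hx₀ hpos hscal
  -- the mass of the majorant outside a large interval
  obtain ⟨R, hR1, hR⟩ : ∃ R : ℝ, 1 ≤ R ∧ ∫ v in (Icc (-R) R)ᶜ, G v ≤ 1 / 4 := by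
    have h1 : Tendsto (fun R : ℝ => ∫ v in Icc (-R) R, G v) atTop (𝓝 (∫ v, G v)) :=
      (aecover_Icc tendsto_neg_atTop_atBot tendsto_id).integral_tendsto_of_countably_generated hGi
    obtain ⟨R, hR, hR1⟩ := ((h1.eventually_const_lt (u := (∫ v, G v) - 1 / 4)
      (by linarith)).and (eventually_ge_atTop 1)).exists
    refine ⟨R, hR1, ?_⟩
    have := integral_add_compl (measurableSet_Icc (a := -R) (b := R)) hGi
    linarith
  have hGint : 0 ≤ ∫ v, G v := integral_nonneg hG0
  -- For `|v| ≤ R` the error is at most `8DR³/(sw)` with `(sw)² = tw²φ''(w)`; the threshold makes it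
  -- at most `1/4`. The constant `8π` is the reciprocal of `(2π)⁻¹ · 1/4`, the lower bound reached
  -- below.
  refine ⟨max 1 ((32 * D * R ^ 3) ^ 2), by positivity, max (8 * Real.pi) (∫ v, G v), ?_, ?_⟩
  · exact le_max_of_le_left (by linarith [Real.pi_gt_three])
  intro t w ht hw hM
  have hA1 : 1 < t * w ^ 2 * realExponentDeriv2 σ ν w := (le_max_left _ _).trans_lt hM
  have hA2 : (32 * D * R ^ 3) ^ 2 < t * w ^ 2 * realExponentDeriv2 σ ν w :=
    (le_max_right _ _).trans_lt hM
  have hw0 : 0 < w := hx₀.trans_lt hw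
  have hfw := hpos w hw0
  have hGw := hG t w ht hw hA1.le
  set s := √(t * realExponentDeriv2 σ ν w) with hs
  have hs0 : 0 < s := Real.sqrt_pos.2 (by positivity)
  have hs2 : s ^ 2 = t * realExponentDeriv2 σ ν w := Real.sq_sqrt (by positivity)
  have hsw : 32 * D * R ^ 3 ≤ s * w := by
    refine le_of_sq_le_sq ?_ (by positivity)
    rw [mul_pow s w, hs2]; linarith
  set F : ℝ → ℂ := fun v => Complex.exp (t * tiltedExponent σ ν w (v / s)) with hF
  have hFi : Integrable F := by
    have hcont := continuous_tiltedExponent hν σ hw0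
    exact hGi.mono' (by fun_prop) (ae_of_all _ hGw)
  have hscale : ∫ ξ : ℝ, Complex.exp (t * tiltedExponent σ ν w ξ) = (s⁻¹ : ℝ) * ∫ v, F v := by
    have h := Measure.integral_comp_div (fun ξ : ℝ => Complex.exp (t * tiltedExponent σ ν w ξ)) s
    rw [abs_of_pos hs0, Complex.real_smul] at h
    rw [hF, h, ← mul_assoc, ← Complex.ofReal_mul, inv_mul_cancel₀ hs0.ne', Complex.ofReal_one,
      one_mul]
  have hre : (∫ v, F v).re = ∫ v, (F v).re := (integral_re hFi).symm
  have hup : (∫ v, F v).re ≤ ∫ v, G v :=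
    (Complex.re_le_norm _).trans (norm_integral_le_of_norm_le hGi (ae_of_all _ hGw))
  -- The real part is at least `1/4` on `[-1, 1]`, contributing `1/2`; it is nonnegative on the rest
  -- of `[-R, R]`; the tail costs at most `1/4`.
  have hlow : 1 / 4 ≤ (∫ v, F v).re := by
    have hi1 : Integrable ((Icc (-1 : ℝ) 1).indicator fun _ => (1 / 4 : ℝ)) :=
      (integrable_indicator_iff measurableSet_Icc).2 (integrable_const _)
    have hi2 : Integrable ((Icc (-R) R)ᶜ.indicator G) := hGi.indicator measurableSet_Icc.compl
    have hpt : ∀ v, (Icc (-1 : ℝ) 1).indicator (fun _ => (1 / 4 : ℝ)) v -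
        (Icc (-R) R)ᶜ.indicator G v ≤ (F v).re := by
      intro v
      by_cases hv : v ∈ Icc (-R) R
      · have hvR : |v| ≤ R := abs_le.2 hv
        rw [indicator_of_notMem (s := (Icc (-R) R)ᶜ) (fun h => h hv), sub_zero]
        set E : ℂ := t * (tiltedExponent σ ν w (v / s) +
          ((realExponentDeriv2 σ ν w * (v / s) ^ 2 / 2 : ℝ) : ℂ)) with hE
        have hEn : ‖E‖ ≤ 1 / 4 := by
          rw [hE, norm_mul, Complex.norm_real, Real.norm_of_nonneg ht.le]
          have h1 := norm_tiltedExponent_add_le hν σ hw0 (v / s)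
          have h2 := hDw w hw
          rw [abs_div, abs_of_pos hs0] at h1
          calc _ ≤ t * (8 * (|v| / s) ^ 3 / w * (D * realExponentDeriv2 σ ν w)) := by
                refine mul_le_mul_of_nonneg_left (h1.trans ?_) ht.le
                gcongr
            _ = 8 * D * |v| ^ 3 * (t * realExponentDeriv2 σ ν w) / s ^ 2 / (s * w) := by
                field_simp
            _ = 8 * D * |v| ^ 3 / (s * w) := by
                rw [← hs2]; field_simp
            _ ≤ 8 * D * R ^ 3 / (s * w) := by gcongr
            _ ≤ 1 / 4 := by
                rw [div_le_div_iff₀ (by positivity) (by norm_num)]; linarith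
        have hFv : F v = Complex.exp (((-(v ^ 2 / 2) : ℝ) : ℂ) + E) := by
          have h3 : realExponentDeriv2 σ ν w * (v / s) ^ 2 / 2 * t = v ^ 2 / 2 := by
            rw [div_pow, hs2]; field_simp
          rw [hF, hE, mul_add, ← Complex.ofReal_mul, mul_comm t, h3]
          refine congrArg Complex.exp ?_
          push_cast; ring
        obtain ⟨h4, h5⟩ := quarter_le_re_exp (v := v) hEn
        rw [hFv]
        by_cases hv1 : v ∈ Icc (-1 : ℝ) 1
        · rw [indicator_of_mem hv1]; exact h5 (abs_le.2 hv1)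
        · rw [indicator_of_notMem hv1]; exact h4
      · rw [indicator_of_mem (s := (Icc (-R) R)ᶜ) hv,
          indicator_of_notMem (s := Icc (-1 : ℝ) 1)]
        · have h1 := (abs_le.1 (Complex.abs_re_le_norm (F v))).1
          have h2 := hGw v
          simp only [hF] at h1 ⊢
          linarith
        · exact fun h => hv ⟨by linarith [h.1], by linarith [h.2]⟩
    have h := integral_mono (hi1.sub hi2) hFi.re hpt
    rw [integral_sub' hi1 hi2, integral_indicator measurableSet_Icc,
      integral_indicator measurableSet_Icc.compl] at h
    have h6 : ∫ _ in Icc (-1 : ℝ) 1, (1 / 4 : ℝ) = 1 / 2 := by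
      simp; norm_num
    rw [h6] at h
    have h7 : ∫ v, RCLike.re (F v) = ∫ v, (F v).re := rfl
    rw [hre]
    linarith
  rw [hscale, Complex.re_ofReal_mul]
  have hpi := Real.pi_pos
  have hsi : 0 < s⁻¹ := inv_pos.2 hs0
  constructor
  · have h1 : (max (8 * Real.pi) (∫ v, G v))⁻¹ ≤ (2 * Real.pi)⁻¹ * (1 / 4) := by
      rw [show (2 * Real.pi)⁻¹ * (1 / 4) = (8 * Real.pi)⁻¹ by field_simp; norm_num]
      exact inv_anti₀ (by positivity) (le_max_left _ _)
    calc _ ≤ (2 * Real.pi)⁻¹ * (1 / 4) * s⁻¹ := by gcongr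
      _ ≤ (2 * Real.pi)⁻¹ * (∫ v, F v).re * s⁻¹ := by gcongr
      _ = _ := by ring
  · have h1 : (2 * Real.pi)⁻¹ ≤ 1 := inv_le_one_of_one_le₀ (by linarith [Real.pi_gt_three])
    calc _ ≤ 1 * (s⁻¹ * ∫ v, G v) := by gcongr
      _ ≤ _ := by
        rw [one_mul, mul_comm]
        gcongr
        exact le_max_right _ _

end

/-! ### Uniqueness of the density, undoing the tilt, and the saddle point. -/

lemma IsContinuousDensity.eq {μ : Measure ℝ} {q q' : ℝ → ℝ} (h : IsContinuousDensity μ q)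
    (h' : IsContinuousDensity μ q') : q = q' := by
  have hm := h.continuous.measurable
  have hm' := h'.continuous.measurable
  have h1 := (withDensity_eq_iff_of_sigmaFinite (μ := (volume : Measure ℝ)) (by fun_prop)
    (by fun_prop)).1 (h.eq_withDensity.symm.trans h'.eq_withDensity)
  refine (Continuous.ae_eq_iff_eq (volume : Measure ℝ) h.continuous h'.continuous).1 ?_
  filter_upwards [h1] with x hx
  exact (ENNReal.ofReal_eq_ofReal_iff (h.nonneg x) (h'.nonneg x)).1 hx

lemma IsContinuousDensity.mul {μ : Measure ℝ} {q g : ℝ → ℝ} (h : IsContinuousDensity μ q)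
    (hg : Continuous g) (hg0 : ∀ x, 0 ≤ g x) :
    IsContinuousDensity (μ.withDensity fun x => ENNReal.ofReal (g x)) (fun x => q x * g x) := by
  refine ⟨h.continuous.mul hg, fun x => mul_nonneg (h.nonneg x) (hg0 x), ?_⟩
  have hm := h.continuous.measurable
  have hm' := hg.measurable
  rw [h.eq_withDensity, ← withDensity_mul _ (by fun_prop) (by fun_prop)]
  congr 1; ext x
  rw [Pi.mul_apply, ENNReal.ofReal_mul (h.nonneg x)]

/-- An exponential tilting is undone by the inverse exponential density. -/
lemma withDensity_tilted_neg_mul {μ : Measure ℝ} [IsProbabilityMeasure μ] {w r : ℝ}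
    (hi : Integrable (fun x : ℝ => Real.exp (-w * x)) μ)
    (hr : ∫ x : ℝ, Real.exp (-w * x) ∂μ = Real.exp r) :
    (μ.tilted fun x => -w * x).withDensity (fun x => ENNReal.ofReal (Real.exp (w * x + r))) = μ := by
  set f : ℝ → ℝ := fun x => -w * x with hf
  have h1 : (μ.tilted f).tilted (-f) = μ := tilted_neg_same hi
  have h2 : ∫ x : ℝ, Real.exp ((-f) x) ∂(μ.tilted f) = (Real.exp r)⁻¹ := by
    rw [integral_exp_tilted, hr]
    simp
  calc _ = (μ.tilted f).withDensity
        (fun x => ENNReal.ofReal (Real.exp ((-f) x) / ∫ x, Real.exp ((-f) x) ∂(μ.tilted f))) := by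
        rw [h2]
        congr 1; ext x
        rw [Real.exp_add, div_inv_eq_mul]
        simp [hf]
    _ = μ := h1

/-- Monotone functions on a half-line: a real number exceeding the right limit at the endpoint
(read in the extended reals, after multiplication by a positive number) exceeds some value. -/
lemma exists_lt_of_lt_neg_mul_rightDerivLimit {f : ℝ → ℝ} {a t x : ℝ} (ht : 0 < t)
    (hf : MonotoneOn (deriv f) (Ioi a))
    (hx : (x : EReal) < -((t : EReal) * rightDerivLimit f a)) :
    ∃ u, a < u ∧ deriv f u < -x / t := by
  by_contra! h
  have hm : MonotoneOn (fun w => ((deriv f w : ℝ) : EReal)) (Ioi a) := fun u hu v hv huv =>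
    EReal.coe_le_coe_iff.2 (hf hu hv huv)
  -- By monotonicity the right limit is an infimum in `EReal`, so the value `-∞` at `0` needs no
  -- separate case.
  have hlim : rightDerivLimit f a = sInf ((fun w => ((deriv f w : ℝ) : EReal)) '' Ioi a) :=
    (hm.tendsto_nhdsGT (OrderBot.bddBelow _)).limUnder_eq
  have hle : ((-x / t : ℝ) : EReal) ≤ rightDerivLimit f a := by
    rw [hlim]
    refine le_sInf ?_
    rintro _ ⟨u, hu, rfl⟩
    exact EReal.coe_le_coe_iff.2 (h u hu)
  have h1 := mul_le_mul_of_nonneg_left hle (EReal.coe_nonneg.2 ht.le)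
  rw [← EReal.coe_mul, mul_div_cancel₀ _ ht.ne'] at h1
  have h2 := EReal.neg_le_neg_iff.2 h1
  rw [← EReal.coe_neg, neg_neg] at h2
  exact absurd hx (not_lt.2 h2)

lemma continuousOn_realExponentDeriv {ν : Measure ℝ} (hν : IsPositiveLevyMeasure ν) (σ b : ℝ) :
    ContinuousOn (realExponentDeriv σ b ν) (Ioi 0) := fun _ hx =>
  (hasDerivAt_realExponentDeriv hν σ b hx).continuousAt.continuousWithinAt

namespace IsSpectrallyPositiveLevy

variable {Ω : Type*} [MeasurableSpace Ω] {P : Measure Ω} [IsProbabilityMeasure P]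
  {X : ℝ≥0 → Ω → ℝ} {σ b : ℝ} {ν : Measure ℝ} (hX : IsSpectrallyPositiveLevy P X σ b ν)
include hX

lemma exists_lt_realExponentDeriv (hvar : IsOfUnboundedVariation P X) (K : ℝ) :
    ∃ l : ℝ, 0 < l ∧ K < realExponentDeriv σ b ν l := by
  by_contra! h
  exact hX.not_isOfUnboundedVariation h hvar

/-- A single zero of `φ''` makes it vanish identically; then `φ'` is constant, hence bounded above,
contradicting unbounded variation. -/
lemma realExponentDeriv2_pos (hvar : IsOfUnboundedVariation P X) {l : ℝ} (hl : 0 < l) :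
    0 < realExponentDeriv2 σ ν l := by
  refine lt_of_le_of_ne (realExponentDeriv2_nonneg σ l) fun h => ?_
  have h0 := realExponentDeriv2_eq_zero hX.levyMeasure σ hl h.symm
  have hd : ∀ x : ℝ, 0 < x → HasDerivAt (realExponentDeriv σ b ν) 0 x := fun x hx => by
    have := hasDerivAt_realExponentDeriv hX.levyMeasure σ b hx
    rwa [h0 x] at this
  have hanti : AntitoneOn (realExponentDeriv σ b ν) (Ioi 0) := by
    refine antitoneOn_of_deriv_nonpos (convex_Ioi 0)
      (fun x hx => (hd x hx).continuousAt.continuousWithinAt) ?_ ?_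
    · exact fun x hx => (hd x (interior_subset hx)).differentiableAt.differentiableWithinAt
    · exact fun x hx => (hd x (interior_subset hx)).deriv.le
  have hmono : MonotoneOn (realExponentDeriv σ b ν) (Ioi 0) := by
    refine monotoneOn_of_deriv_nonneg (convex_Ioi 0)
      (fun x hx => (hd x hx).continuousAt.continuousWithinAt) ?_ ?_
    · exact fun x hx => (hd x (interior_subset hx)).differentiableAt.differentiableWithinAt
    · exact fun x hx => (hd x (interior_subset hx)).deriv.ge
  obtain ⟨u, hu, hlt⟩ := hX.exists_lt_realExponentDeriv hvar (realExponentDeriv σ b ν 1)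
  rcases le_total u 1 with h1 | h1
  · exact absurd (hmono hu (mem_Ioi.2 one_pos) h1) (not_le.2 hlt)
  · exact absurd (hanti (mem_Ioi.2 one_pos) hu h1) (not_le.2 hlt)

lemma strictMonoOn_realExponentDeriv (hvar : IsOfUnboundedVariation P X) :
    StrictMonoOn (realExponentDeriv σ b ν) (Ioi 0) := by
  refine strictMonoOn_of_deriv_pos (convex_Ioi 0) (continuousOn_realExponentDeriv hX.levyMeasure σ b) fun x hx => ?_
  have hx0 : 0 < x := interior_subset hx
  rw [(hasDerivAt_realExponentDeriv hX.levyMeasure σ b hx0).deriv]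
  exact hX.realExponentDeriv2_pos hvar hx0

/-- The saddle point `(φ')⁻¹(-x/t)` is well defined and larger than `x₀` when
`x < -t φ'(x₀+)`. -/
lemma derivInv_spec (hvar : IsOfUnboundedVariation P X) {x₀ t x : ℝ} (hx₀ : 0 ≤ x₀) (ht : 0 < t)
    (hx : (x : EReal) < -((t : EReal) * rightDerivLimit (laplaceExponent P X) x₀)) :
    x₀ < derivInv (laplaceExponent P X) (-x / t) ∧
      deriv (laplaceExponent P X) (derivInv (laplaceExponent P X) (-x / t)) = -x / t := by
  have hd : ∀ l ∈ Ioi (0 : ℝ), deriv (laplaceExponent P X) l = realExponentDeriv σ b ν l :=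
    fun l hl => hX.deriv_laplaceExponent hl
  have hmono : StrictMonoOn (deriv (laplaceExponent P X)) (Ioi 0) :=
    (hX.strictMonoOn_realExponentDeriv hvar).congr fun l hl => (hd l hl).symm
  have hcont : ContinuousOn (deriv (laplaceExponent P X)) (Ioi 0) :=
    (continuousOn_realExponentDeriv hX.levyMeasure σ b).congr hd
  obtain ⟨u, hu, hu'⟩ := exists_lt_of_lt_neg_mul_rightDerivLimit ht
    (hmono.monotoneOn.mono (Ioi_subset_Ioi hx₀)) hx
  have hu0 : 0 < u := hx₀.trans_lt hu
  obtain ⟨v, hv0, hv'⟩ := hX.exists_lt_realExponentDeriv hvar (-x / t)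
  rw [← hd v hv0] at hv'
  have huv : u < v := (hmono.lt_iff_lt hu0 hv0).1 (hu'.trans hv')
  obtain ⟨y, hy, hyx⟩ := intermediate_value_Icc huv.le
    (hcont.mono fun z hz => hu0.trans_le hz.1) ⟨hu'.le, hv'.le⟩
  have hex : ∃ a ∈ Ioi (0 : ℝ), deriv (laplaceExponent P X) a = -x / t :=
    ⟨y, hu0.trans_le hy.1, hyx⟩
  have h1 : derivInv (laplaceExponent P X) (-x / t) ∈ Ioi (0 : ℝ) := Function.invFunOn_mem hex
  have h2 : deriv (laplaceExponent P X) (derivInv (laplaceExponent P X) (-x / t)) = -x / t :=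
    Function.invFunOn_eq hex
  refine ⟨?_, h2⟩
  rw [hmono.injOn h1 (hu0.trans_le hy.1) (h2.trans hyx.symm)]
  exact hu.trans_le hy.1

lemma charFun_tilted (t : ℝ≥0) {w : ℝ} (hw : 0 < w) (ξ : ℝ) :
    charFun ((P.map (X t)).tilted fun x => -w * x) ξ =
      Complex.exp (-(ξ * (t * realExponentDeriv σ b ν w) * Complex.I)) *
        Complex.exp (t * tiltedExponent σ ν w ξ) := by
  have h1 := (hX.integral_rexp_map t hw.le).2
  have h2 := (hX.integral_cexp t (z := w - ξ * Complex.I) (by simp [hw.le])).2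
  rw [charFun_apply_real, integral_tilted, h1]
  have e : ∀ x : ℝ, (Real.exp (-w * x) / Real.exp (t * realExponent σ b ν w)) •
      Complex.exp (ξ * x * Complex.I) =
      Complex.exp (-(t * realExponent σ b ν w)) * Complex.exp (-(w - ξ * Complex.I) * x) := by
    intro x
    rw [← Real.exp_sub, Complex.real_smul, Complex.ofReal_exp, ← Complex.exp_add,
      ← Complex.exp_add]
    push_cast; ring_nf
  simp_rw [e]
  rw [integral_const_mul, h2, ← Complex.exp_add, ← Complex.exp_add,
    ← complexExponent_sub hX.levyMeasure σ b hw ξ]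
  refine congrArg Complex.exp ?_
  ring

/-- The transition density of the process, obtained by inverting the Fourier transform of the law
tilted by `e^{-wx}`. -/
lemma isContinuousDensity_tilted (t : ℝ≥0) {w : ℝ} (hw : 0 < w)
    (hint : Integrable fun ξ : ℝ => Complex.exp (t * tiltedExponent σ ν w ξ)) :
    IsContinuousDensity (P.map (X t)) (fun x =>
      inversionDensity ((P.map (X t)).tilted fun x => -w * x) x *
        Real.exp (w * x + t * realExponent σ b ν w)) := by
  have hμ := hX.isProbabilityMeasure_map t
  obtain ⟨h1, h2⟩ := hX.integral_rexp_map t hw.le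
  have hμ' : IsProbabilityMeasure ((P.map (X t)).tilted fun x => -w * x) :=
    isProbabilityMeasure_tilted h1
  have hci : Integrable (charFun ((P.map (X t)).tilted fun x => -w * x)) := by
    refine hint.mono (by fun_prop) (ae_of_all _ fun ξ => ?_)
    rw [hX.charFun_tilted t hw, norm_mul]
    have : ‖Complex.exp (-(ξ * (t * realExponentDeriv σ b ν w) * Complex.I))‖ = 1 := by
      rw [← neg_mul]
      exact_mod_cast Complex.norm_exp_ofReal_mul_I (-(ξ * (t * realExponentDeriv σ b ν w)))
    rw [this, one_mul]
  have h3 := (isContinuousDensity_inversionDensity hci).mul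
    (g := fun x => Real.exp (w * x + t * realExponent σ b ν w)) (by fun_prop)
    (fun x => (Real.exp_pos _).le)
  rwa [withDensity_tilted_neg_mul h1 h2] at h3

/-- The point `-tφ'(w)` is the mean of the tilted law, so the phase of the inversion integral
cancels that of the characteristic function. -/
lemma inversionDensity_tilted (t : ℝ≥0) {w : ℝ} (hw : 0 < w) :
    inversionDensity ((P.map (X t)).tilted fun x => -w * x) (-(t * realExponentDeriv σ b ν w)) =
      (2 * Real.pi)⁻¹ * (∫ ξ : ℝ, Complex.exp (t * tiltedExponent σ ν w ξ)).re := by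
  unfold inversionDensity
  simp_rw [hX.charFun_tilted t hw]
  congr 3
  ext ξ
  rw [← mul_assoc, ← Complex.exp_add]
  have : -((ξ : ℂ) * ((-(t * realExponentDeriv σ b ν w) : ℝ) : ℂ) * Complex.I) +
      -(ξ * (t * realExponentDeriv σ b ν w) * Complex.I) = 0 := by
    push_cast; ring
  rw [this, Complex.exp_zero, one_mul]

end IsSpectrallyPositiveLevy

end SpectrallyPositive

theorem corollary1 {Ω : Type*} [MeasurableSpace Ω] (P : Measure Ω) [IsProbabilityMeasure P]
    (X : ℝ≥0 → Ω → ℝ) (σ b : ℝ) (ν : Measure ℝ)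
    (hX : SpectrallyPositive.IsSpectrallyPositiveLevy P X σ b ν)
    (hvar : SpectrallyPositive.IsOfUnboundedVariation P X)
    (φ : ℝ → ℝ) (hφ : φ = SpectrallyPositive.laplaceExponent P X)
    (α c x₀ : ℝ) (hα : 0 < α) (hc : 0 < c) (hc1 : c ≤ 1) (hx₀ : 0 ≤ x₀)
    (hscal : SpectrallyPositive.WLSC (deriv (deriv φ)) (α - 2) c x₀) :
    ∃ p : ℝ≥0 → ℝ → ℝ,
      (∀ t : ℝ≥0, 0 < t → SpectrallyPositive.IsContinuousDensity (P.map (X t)) (p t)) ∧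
      ∃ M₀ : ℝ, 0 < M₀ ∧ ∃ C : ℝ, 1 ≤ C ∧
        ∀ (t : ℝ≥0) (x w : ℝ), 0 < t →
          (x : EReal) < -(((t : ℝ) : EReal) * SpectrallyPositive.rightDerivLimit φ x₀) →
          w = SpectrallyPositive.derivInv φ (-x / t) →
          (x₀ < w ∧ deriv φ w = -x / t) ∧
          (M₀ < t * w ^ 2 * deriv (deriv φ) w →
            C⁻¹ * ((Real.sqrt (t * deriv (deriv φ) w))⁻¹ *
                Real.exp (-t * (w * deriv φ w - φ w))) ≤ p t x ∧
            p t x ≤ C * ((Real.sqrt (t * deriv (deriv φ) w))⁻¹ *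
                Real.exp (-t * (w * deriv φ w - φ w)))) := by
  open SpectrallyPositive in
  subst hφ
  have hν := hX.levyMeasure
  have hpos : ∀ l : ℝ, 0 < l → 0 < realExponentDeriv2 σ ν l :=
    fun l hl => hX.realExponentDeriv2_pos hvar hl
  have hscal1 : WLSC (realExponentDeriv2 σ ν) (α - 2) c x₀ := by
    intro l hl x hx
    have hx0 : 0 < x := hx₀.trans_lt hx
    have h := hscal l hl x hx
    rwa [hX.deriv_deriv_laplaceExponent hx0,
      hX.deriv_deriv_laplaceExponent (mul_pos (by linarith) hx0)] at h
  -- The uniform majorant needs a scaling exponent at most `2`; existence of the density works with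
  -- `α` itself.
  have hscal2 : WLSC (realExponentDeriv2 σ ν) (min α 2 - 2) c x₀ :=
    hscal1.mono_exponent (sub_le_sub_right (min_le_left α 2) 2) hc.le
      fun x => realExponentDeriv2_nonneg σ x
  have hdens : ∀ (t : ℝ≥0), 0 < t → ∀ w : ℝ, x₀ < w → IsContinuousDensity (P.map (X t)) (fun x =>
      inversionDensity ((P.map (X t)).tilted fun x => -w * x) x *
        Real.exp (w * x + t * realExponent σ b ν w)) := fun t ht w hw =>
    hX.isContinuousDensity_tilted t (hx₀.trans_lt hw) (integrable_exp_mul_tiltedExponent hν hα hc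
      hc1 hx₀ hpos hscal1 (by exact_mod_cast ht) hw)
  obtain ⟨M₀, hM₀, C, hC, hbound⟩ := exists_bounds_integral_tiltedExponent hν
    (lt_min hα two_pos) (min_le_right α 2) hc hc1 hx₀ hpos hscal2
  -- The tilt `x₀ + 1` is an arbitrary choice above `x₀`; uniqueness of continuous densities later
  -- replaces it by the saddle point `w`.
  refine ⟨_, fun t ht => hdens t ht (x₀ + 1) (by linarith), M₀, hM₀, C, hC,
    fun t x w ht hx hw => ?_⟩
  have ht0 : (0 : ℝ) < t := by exact_mod_cast ht
  have hspec := hX.derivInv_spec hvar hx₀ ht0 hx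
  rw [← hw] at hspec
  refine ⟨hspec, fun hM => ?_⟩
  have hw0 : 0 < w := hx₀.trans_lt hspec.1
  have hp := congrFun ((hdens t ht (x₀ + 1) (by linarith)).eq (hdens t ht w hspec.1)) x
  have hφ' := hX.deriv_laplaceExponent hw0
  rw [hX.deriv_deriv_laplaceExponent hw0] at hM ⊢
  have hxw : x = -(t * realExponentDeriv σ b ν w) := by
    rw [← hφ', hspec.2]; field_simp
  have hexp : -(t : ℝ) * (w * realExponentDeriv σ b ν w - realExponent σ b ν w) =
      w * x + t * realExponent σ b ν w := by rw [hxw]; ring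
  rw [hp, hφ', hX.laplaceExponent_eq hw0.le, hexp]
  have hinv := hX.inversionDensity_tilted t hw0
  rw [← hxw] at hinv
  rw [hinv]
  obtain ⟨h1, h2⟩ := hbound t w ht0 hspec.1 hM
  have he := (Real.exp_pos (w * x + t * realExponent σ b ν w)).le
  rw [← mul_assoc, ← mul_assoc]
  exact ⟨mul_le_mul_of_nonneg_right h1 he, mul_le_mul_of_nonneg_right h2 he⟩
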